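/- \textbf{Setting.} Write $e(z)=\exp(2\pi i z)$. An even lattice $L$ is a finitely generated subgroup spanning a rational vector space $V$ with a nondegenerate symmetric bilinear form $(\cdot,\cdot)$ such that $(l,l)\in 2\mathbb Z$ for all $l\in L$; put $L'=\{x\in V:(x,L)\subset\mathbb Z\}$. If $L$ has signature $(b^+,b^-)$, then $\rho_L$ is the Weil representation of $\mathrm{Mp}_2(\mathbb Z)$ on $\mathbb C[L'/L]$, determined by $$\rho_L(\widetilde T)e_\nu=e((\nu,\nu)/2)\,e_\nu,\qquad \rho_L(\widetilde S)e_\nu=i^{b^- /2-b^+/2}\,|L'/L|^{-1/2}\sum_{\mu\in L'/L}e(-(\mu,\nu))\,e_\mu,$$ where $\widetilde T=\left(\begin{pmatrix}1&1\\0&1\end{pmatrix},1\right)$ and $\widetilde S=\left(\begin{pmatrix}0&-1\\1&0\end{pmatrix},\sqrt\tau\right)$. For half-integral $k$, $M^!_k(\rho_L)$ is the space of weakly holomorphic forms of weight $k$ and representation $\rho_L$: holomorphic functions $f=\sum_\nu f_\nu e_\nu:\mathfrak H\to\mathbb C[L'/L]$ with $f(A\tau)=\phi(\tau)^{2k}\rho_L(A,\phi)f(\tau)$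 for all $(A,\phi)\in\mathrm{Mp}_2(\mathbb Z)$ that are meromorphic at the cusp, i.e. have Fourier expansions $f_\nu(\tau)=\sum_{n\in\mathbb Q,\,n\gg-\infty}c_\nu(n)e(n\tau)$. The constant term of $f$ is $c_0(0)$. Let $V=V_1\oplus V_2$ be an orthogonal decomposition over $\mathbb Q$ with $V_2$ negative definite, and let $N=L\cap V_1$, $M=L\cap V_2$. For a $\mathbb C[L'/L]$-valued function $h=\sum_\lambda h_\lambda e_\lambda$, define $T_{L,N}(h)=\sum_{\nu\in N'/N}g_\nu e_\nu$ by $$g_\nu(\tau)=\sum_{\lambda\in L'/L}\vartheta_{\lambda,\nu}(\tau)\,h_\lambda(\tau),\qquad \vartheta_{\lambda,\nu}(\tau)=\sum_{m\in M',\ m+\nu\in\lambda+L}e(-\tau (m,m)/2).$$ \textbf{Theorem.} Let $N$ be an even lattice of signature $(2,0)$ and let $f\in M^!_1(\rho_N)$ have rational Fourier coefficients and zero constant term. Then there exist an even lattice $P$ of signature $(2,1)$ and a function $h\in M^!_{1/2}(\rho_P)$ such that \begin{enumerate} \item $N\subset P$; more precisely, $N=P\cap(N\otimes\mathbb Q)$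 for an isometric embedding of $N\otimes\mathbb Q$ into $P\otimes\mathbb Q$; \item $P$ contains a primitive (in particular nonzero) vector $z$ with $(z,z)=0$; \item all Fourier coefficients of $h$ are rational; \item the constant term of $h$ is zero; \item $T_{P,N}(h)=f$. \end{enumerate} -/

import Mathlib

open scoped UpperHalfPlane Manifold MatrixGroups

universe u

noncomputable section

/-- `e(z) = exp(2πiz)`. -/
def ee (z : ℂ) : ℂ := Complex.exp (2 * Real.pi * Complex.I * z)

theorem ee_add_int (z : ℂ) (n : ℤ) : ee (z + n) = ee z := by
  rw [ee, ee, mul_add, Complex.exp_add]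
  have : Complex.exp (2 * Real.pi * Complex.I * (n : ℂ)) = 1 := by
    rw [mul_comm]; exact Complex.exp_int_mul_two_pi_mul_I n
  rw [this, mul_one]

/-! ### The metaplectic group -/

/-- The metaplectic group `Mp₂(ℤ)`: pairs `(A, φ)` of a matrix `A = (a b; c d)` in `SL₂(ℤ)` and a
holomorphic function `φ` on the upper half plane with `φ(τ)² = cτ + d`. -/
@[ext]
structure Mp2Z where
  mat : SL(2, ℤ)
  root : ℍ → ℂ
  holo : MDiff root
  sq : ∀ τ : ℍ, root τ ^ 2 = (mat 1 0 : ℂ) * τ + (mat 1 1 : ℂ)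

namespace Mp2Z

theorem denom_mul (A B : SL(2, ℤ)) (τ : ℍ) :
    (((A * B : SL(2, ℤ)) 1 0 : ℤ) : ℂ) * τ + ((A * B : SL(2, ℤ)) 1 1 : ℤ) =
      ((A 1 0 : ℂ) * (B • τ : ℍ) + (A 1 1 : ℂ)) * ((B 1 0 : ℂ) * τ + (B 1 1 : ℂ)) := by
  have h := UpperHalfPlane.denom_cocycle_σ (A : GL (Fin 2) ℝ) (B : GL (Fin 2) ℝ) τ
  have e : ((A * B : SL(2, ℤ)) : GL (Fin 2) ℝ) = (A : GL (Fin 2) ℝ) * (B : GL (Fin 2) ℝ) := by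
    simp
  rw [← e, ModularGroup.denom_apply, ModularGroup.denom_apply, ModularGroup.denom_apply] at h
  simpa [-Matrix.SpecialLinearGroup.coe_mul, UpperHalfPlane.σ] using h

theorem root_ne_zero (g : Mp2Z) (τ : ℍ) : g.root τ ≠ 0 := by
  intro h
  have h2 := g.sq τ
  rw [h, ← ModularGroup.denom_apply] at h2
  exact UpperHalfPlane.denom_ne_zero (g.mat : GL (Fin 2) ℝ) τ (by simpa using h2.symm)

theorem mdiff_smul (A : SL(2, ℤ)) : MDiff (fun τ : ℍ => A • τ) :=
  UpperHalfPlane.mdifferentiable_smul (g := (A : GL (Fin 2) ℝ)) (by simp)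

/-- `(A, φ)(B, ψ) = (AB, φ(Bτ)ψ(τ))`. -/
instance : Mul Mp2Z where
  mul g h :=
    { mat := g.mat * h.mat
      root := fun τ => g.root (h.mat • τ) * h.root τ
      holo := (g.holo.comp (mdiff_smul h.mat)).mul h.holo
      sq := fun τ => by rw [mul_pow, g.sq, h.sq, denom_mul] }

instance : One Mp2Z where
  one :=
    { mat := 1
      root := fun _ => 1
      holo := mdifferentiable_const
      sq := fun τ => by simp }

instance : Inv Mp2Z where
  inv g :=
    { mat := g.mat⁻¹
      root := fun τ => (g.root (g.mat⁻¹ • τ))⁻¹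
      holo := by
        have h1 : MDiff (fun τ : ℍ => g.root (g.mat⁻¹ • τ)) := g.holo.comp (mdiff_smul g.mat⁻¹)
        intro τ
        have h2 : DifferentiableAt ℂ (fun z : ℂ => z⁻¹) (g.root (g.mat⁻¹ • τ)) :=
          differentiableAt_inv (g.root_ne_zero _)
        exact h2.mdifferentiableAt.comp τ (h1 τ)
      sq := fun τ => by
        have h := denom_mul g.mat g.mat⁻¹ τ
        rw [mul_inv_cancel] at h
        rw [inv_pow, g.sq]
        refine inv_eq_of_mul_eq_one_right ?_
        rw [← h]; simp }

@[simp] theorem mat_mul (g h : Mp2Z) : (g * h).mat = g.mat * h.mat := rfl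
@[simp] theorem root_mul (g h : Mp2Z) (τ : ℍ) :
    (g * h).root τ = g.root (h.mat • τ) * h.root τ := rfl
@[simp] theorem mat_one : (1 : Mp2Z).mat = 1 := rfl
@[simp] theorem root_one (τ : ℍ) : (1 : Mp2Z).root τ = 1 := rfl
@[simp] theorem mat_inv (g : Mp2Z) : (g⁻¹).mat = g.mat⁻¹ := rfl
@[simp] theorem root_inv (g : Mp2Z) (τ : ℍ) :
    (g⁻¹).root τ = (g.root (g.mat⁻¹ • τ))⁻¹ := rfl

instance : Group Mp2Z where
  mul_assoc a b c := by
    ext1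
    · simp [mul_assoc]
    · funext τ; simp [mul_assoc, mul_smul]
  one_mul a := by
    ext1
    · simp
    · funext τ; simp
  mul_one a := by
    ext1
    · simp
    · funext τ; simp
  inv_mul_cancel a := by
    ext1
    · simp
    · funext τ; simp [a.root_ne_zero]

/-- `T̃ = ((1 1; 0 1), 1)`. -/
def T : Mp2Z where
  mat := ModularGroup.T
  root := fun _ => 1
  holo := mdifferentiable_const
  sq := fun τ => by simp [ModularGroup.T]

/-- `S̃ = ((0 -1; 1 0), √τ)`, with the principal branch of the square root. -/
def S : Mp2Z where
  mat := ModularGroup.S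
  root := fun τ => (τ : ℂ) ^ (1 / 2 : ℂ)
  holo := by
    rw [UpperHalfPlane.mdifferentiable_iff]
    intro z hz
    have h1 : DifferentiableAt ℂ (fun z : ℂ => z ^ (1 / 2 : ℂ)) z :=
      differentiableAt_id.cpow_const (Or.inr (ne_of_gt hz))
    refine h1.differentiableWithinAt.congr (fun w hw => ?_) ?_
    · simp [UpperHalfPlane.ofComplex_apply_of_im_pos hw]
    · simp [UpperHalfPlane.ofComplex_apply_of_im_pos hz]
  sq := fun τ => by
    rw [← Complex.cpow_nat_mul]
    simp [ModularGroup.S]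

end Mp2Z

/-! ### Even lattices -/

/-- An even lattice `L` in a rational quadratic space: a symmetric nondegenerate bilinear form
`(·,·)` on a `ℚ`-vector space `V`, and a finitely generated subgroup `L` spanning `V` such that
`(l,l) ∈ 2ℤ` for all `l ∈ L`. -/
structure EvenLattice (V : Type u) [AddCommGroup V] [Module ℚ V] where
  form : LinearMap.BilinForm ℚ V
  symm : form.IsSymm
  nondegenerate : form.Nondegenerate
  carrier : Submodule ℤ V
  fg : carrier.FG
  span_eq_top : Submodule.span ℚ (carrier : Set V) = ⊤
  even : ∀ l ∈ carrier, ∃ n : ℤ, form l l = 2 * n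

namespace EvenLattice

variable {V : Type u} [AddCommGroup V] [Module ℚ V] (L : EvenLattice V)

/-- The signature `(b⁺, b⁻)`. -/
def signature : ℕ × ℕ :=
  (sigPos (LinearMap.BilinMap.toQuadraticMap L.form),
    sigNeg (LinearMap.BilinMap.toQuadraticMap L.form))

/-- The dual lattice `L' = {x ∈ V | (x, L) ⊂ ℤ}`. -/
def dual : Submodule ℤ V := L.form.dualSubmodule L.carrier

theorem mem_dual {x : V} : x ∈ L.dual ↔ ∀ y ∈ L.carrier, ∃ n : ℤ, L.form x y = n := by
  simp only [dual, LinearMap.BilinForm.mem_dualSubmodule, Submodule.mem_one]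
  simp [eq_comm]

/-- The discriminant group `L'/L`. -/
abbrev Disc : Type u := L.dual ⧸ L.carrier.submoduleOf L.dual

theorem finite_disc : Finite L.Disc := by
  classical
  have hB := L.nondegenerate
  -- the dual lattice is finitely generated
  obtain ⟨s, hs⟩ := L.fg
  have hspan : Submodule.span ℚ (s : Set V) = ⊤ := by
    rw [← L.span_eq_top, ← hs]
    exact (Submodule.span_span_of_tower ℤ ℚ (s : Set V)).symm
  obtain ⟨t, hts, b, hb⟩ : ∃ t : Set V, t ⊆ s ∧ ∃ b : Module.Basis t ℚ V, ∀ i, b i = i := by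
    obtain ⟨t, hts, hsp, hli⟩ := exists_linearIndependent ℚ (s : Set V)
    refine ⟨t, hts, Module.Basis.mk hli (by simp [hsp, hspan]), fun i => by simp⟩
  have : Finite t := (s.finite_toSet.subset hts).to_subtype
  have hfgt : (L.form.dualSubmodule (Submodule.span ℤ (Set.range b))).FG := by
    rw [LinearMap.BilinForm.dualSubmodule_span_of_basis _ hB]
    exact Submodule.fg_span (Set.finite_range _)
  have hle : L.dual ≤ L.form.dualSubmodule (Submodule.span ℤ (Set.range b)) := by
    intro x hx y hy
    refine hx y ?_
    have : Submodule.span ℤ (Set.range b) ≤ L.carrier := by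
      rw [← hs, Submodule.span_le]
      rintro _ ⟨i, rfl⟩
      rw [hb]
      exact Submodule.subset_span (hts i.2)
    exact this hy
  have hfin : Module.Finite ℤ L.dual := by
    have : Module.Finite ℤ (L.form.dualSubmodule (Submodule.span ℤ (Set.range b))) :=
      Module.Finite.iff_fg.mpr hfgt
    exact Module.Finite.of_injective (Submodule.inclusion hle) (Submodule.inclusion_injective hle)
  have : Module.Finite ℤ L.Disc := inferInstance
  refine Module.finite_of_fg_torsion _ ?_
  -- every vector has a multiple in the lattice
  have key : ∀ x : V, ∃ n : ℤ, n ≠ 0 ∧ n • x ∈ L.carrier := by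
    intro x
    have hx : x ∈ Submodule.span ℚ (L.carrier : Set V) := by rw [L.span_eq_top]; trivial
    induction hx using Submodule.span_induction with
    | mem x h => exact ⟨1, one_ne_zero, by simpa using h⟩
    | zero => exact ⟨1, one_ne_zero, by simp⟩
    | add x y _ _ hx hy =>
      obtain ⟨n, hn, hx⟩ := hx
      obtain ⟨m, hm, hy⟩ := hy
      refine ⟨n * m, mul_ne_zero hn hm, ?_⟩
      rw [smul_add]
      refine add_mem ?_ ?_
      · rw [mul_comm, mul_smul]; exact L.carrier.smul_mem _ hx
      · rw [mul_smul]; exact L.carrier.smul_mem _ hy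
    | smul a x _ hx =>
      obtain ⟨n, hn, hx⟩ := hx
      refine ⟨n * a.den, mul_ne_zero hn (by exact_mod_cast a.den_ne_zero), ?_⟩
      have : (n * (a.den : ℤ)) • a • x = a.num • n • x := by
        simp only [← Int.cast_smul_eq_zsmul ℚ, smul_smul]
        congr 1
        push_cast
        rw [mul_assoc, Rat.den_mul_eq_num, mul_comm]
      rw [this]
      exact L.carrier.smul_mem _ hx
  intro q
  induction q using Submodule.Quotient.induction_on with
  | _ x =>
    obtain ⟨n, hn, hx⟩ := key x
    refine ⟨⟨n, mem_nonZeroDivisors_of_ne_zero hn⟩, ?_⟩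
    change n • (Submodule.Quotient.mk x : L.Disc) = 0
    rw [← Submodule.Quotient.mk_smul, Submodule.Quotient.mk_eq_zero]
    exact hx

instance : Finite L.Disc := L.finite_disc

instance : Fintype L.Disc := Fintype.ofFinite _

/-- `e((ν,ν)/2)` for `ν ∈ L'/L`. -/
def eNorm (ν : L.Disc) : ℂ :=
  Quotient.liftOn' ν (fun x => ee ((L.form x x : ℚ) / 2)) (by
    intro x y hxy
    have hxy : (x - y : V) ∈ L.carrier := (Submodule.quotientRel_def (L.carrier.submoduleOf L.dual)).1 hxy
    obtain ⟨n, hn⟩ := L.even _ hxy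
    obtain ⟨m, hm⟩ := L.mem_dual.1 y.2 _ hxy
    have hs : L.form (x - y : V) y = m := (L.symm.eq _ _).symm.trans hm
    have h : L.form x x = L.form y y + 2 * ((n + m : ℤ) : ℚ) := by
      have hx : (x : V) = (x - y : V) + y := by abel
      rw [hx]
      simp only [map_add, LinearMap.add_apply, hn, hm, hs]
      push_cast; ring
    have h' : (((L.form x x : ℚ) : ℂ)) / 2 = ((L.form y y : ℚ) : ℂ) / 2 + ((n + m : ℤ) : ℂ) := by
      rw [h]; push_cast; ring
    simp only [h', ee_add_int])

/-- `e(-(μ,ν))` for `μ, ν ∈ L'/L`. -/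
def ePair (μ ν : L.Disc) : ℂ :=
  Quotient.liftOn₂' μ ν (fun x y => ee (-(L.form x y : ℚ))) (by
    intro x y x' y' hx hy
    have hx : (x - x' : V) ∈ L.carrier := (Submodule.quotientRel_def (L.carrier.submoduleOf L.dual)).1 hx
    have hy : (y - y' : V) ∈ L.carrier := (Submodule.quotientRel_def (L.carrier.submoduleOf L.dual)).1 hy
    obtain ⟨n, hn⟩ := L.mem_dual.1 y.2 _ hx
    obtain ⟨m, hm⟩ := L.mem_dual.1 x'.2 _ hy
    replace hn := (L.symm.eq _ _).symm.trans hn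
    have h : L.form x y = L.form x' y' + ((n + m : ℤ) : ℚ) := by
      push_cast
      rw [← hn, ← hm]
      simp only [map_sub, LinearMap.sub_apply]
      ring
    have h' : -((L.form x y : ℚ) : ℂ) = -((L.form x' y' : ℚ) : ℂ) + ((-(n + m) : ℤ) : ℂ) := by
      rw [h]; push_cast; ring
    simp only [h', ee_add_int])

/-! ### The Weil representation and vector valued modular forms

`ℂ[L'/L]` is the space of functions `L'/L → ℂ`; the basis vector `e_ν` is the indicator function
of `ν`. -/

/-- `ρ_L(T̃) e_ν = e((ν,ν)/2) e_ν`. -/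
def weilT : Module.End ℂ (L.Disc → ℂ) where
  toFun v := fun ν => L.eNorm ν * v ν
  map_add' v w := by funext ν; simp [mul_add]
  map_smul' a v := by funext ν; simp [mul_left_comm]

/-- `ρ_L(S̃) e_ν = i^{b⁻/2 - b⁺/2} |L'/L|^{-1/2} ∑_μ e(-(μ,ν)) e_μ`. -/
def weilS : Module.End ℂ (L.Disc → ℂ) :=
  (Complex.I ^ ((L.signature.2 : ℂ) / 2 - (L.signature.1 : ℂ) / 2) *
      ((Real.sqrt (Nat.card L.Disc))⁻¹ : ℝ)) •
    Matrix.mulVecLin (Matrix.of fun μ ν : L.Disc => L.ePair μ ν)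

/-- The graph of the Weil representation `ρ_L` of `Mp₂(ℤ)` on `ℂ[L'/L]`, as a set of pairs
`(γ, ρ_L(γ))`: since `S̃` and `T̃` generate `Mp₂(ℤ)` (also as a monoid, because `S̃⁸ = 1` and
`(S̃T̃)³ = S̃²`), it is generated by `(S̃, ρ_L(S̃))` and `(T̃, ρ_L(T̃))`. -/
def weilGraph : Submonoid (Mp2Z × Module.End ℂ (L.Disc → ℂ)) :=
  Submonoid.closure {(Mp2Z.S, L.weilS), (Mp2Z.T, L.weilT)}

/-- `f(Aτ) = φ(τ)^{2k} ρ_L(A, φ) f(τ)` for all `(A, φ) ∈ Mp₂(ℤ)`; here `κ = 2k`. -/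
def Transforms (κ : ℤ) (f : ℍ → L.Disc → ℂ) : Prop :=
  ∀ γ R, (γ, R) ∈ L.weilGraph → ∀ τ : ℍ, f (γ.mat • τ) = γ.root τ ^ κ • R (f τ)

/-- `f_λ(τ) = ∑_{n ∈ ℚ} c_λ(n) e(nτ)` for all `λ ∈ L'/L`, where `c_λ(n) = 0` for `n ≪ 0`. The
series converges absolutely on the upper half plane, so that `f` determines the `c_λ(n)`. -/
structure IsFourierExpansion (f : ℍ → L.Disc → ℂ) (c : L.Disc → ℚ → ℂ) : Prop where
  bounded_below : ∃ n₀ : ℚ, ∀ ν, ∀ n < n₀, c ν n = 0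
  hasSum : ∀ ν (τ : ℍ), HasSum (fun n : ℚ => c ν n * ee (n * τ)) (f τ ν)

/-- The space `M^!_k(ρ_L)`, with `κ = 2k`: holomorphic on the upper half plane, modular of weight
`k` and representation `ρ_L`, meromorphic at the cusp. -/
structure IsWeaklyHolomorphic (κ : ℤ) (f : ℍ → L.Disc → ℂ) : Prop where
  holo : ∀ ν, MDiff (fun τ => f τ ν)
  transforms : L.Transforms κ f
  meromorphic_at_cusp : ∃ c, L.IsFourierExpansion f c

/-- All Fourier coefficients are rational. -/
def HasRationalCoeffs (f : ℍ → L.Disc → ℂ) : Prop :=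
  ∃ c, L.IsFourierExpansion f c ∧ ∀ ν n, ∃ r : ℚ, c ν n = r

/-- The constant term `c_0(0)` vanishes. -/
def HasZeroConstantTerm (f : ℍ → L.Disc → ℂ) : Prop :=
  ∃ c, L.IsFourierExpansion f c ∧ c 0 0 = 0

/-- `z` is a primitive vector of `L`: a nonzero vector which is not a proper multiple of another
vector of `L`. -/
def IsPrimitive (z : V) : Prop :=
  z ∈ L.carrier ∧ z ≠ 0 ∧ ∀ (k : ℤ), ∀ y ∈ L.carrier, z = k • y → IsUnit k

/-! ### The map `T_{L,N}` -/

variable {W : Type u} [AddCommGroup W] [Module ℚ W]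

/-- An inclusion `N ⊂ L` of even lattices of the kind for which `T_{L,N}` is defined: an isometric
embedding of the rational quadratic space `V₁` of `N` into that of `L` such that `N = L ∩ V₁`. -/
structure Inclusion (N : EvenLattice V) (L : EvenLattice W) where
  toLin : V →ₗ[ℚ] W
  isometry : ∀ x y, L.form (toLin x) (toLin y) = N.form x y
  mem_iff : ∀ x, toLin x ∈ L.carrier ↔ x ∈ N.carrier

namespace Inclusion

variable {N : EvenLattice V} {L : EvenLattice W} (i : Inclusion N L)

/-- The lattice `M = L ∩ V₂`, where `V₂` is the orthogonal complement of `V₁`. -/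
def perp : Set W := {m | m ∈ L.carrier ∧ ∀ x, L.form (i.toLin x) m = 0}

/-- The dual lattice `M' ⊂ V₂` of `M`. -/
def perpDual : Set W :=
  {m | (∀ x, L.form (i.toLin x) m = 0) ∧ ∀ y ∈ i.perp, ∃ n : ℤ, L.form m y = n}

/-- `{m ∈ M' | m + ν ∈ λ + L}` for `λ ∈ L'/L` and `ν ∈ N'/N`. -/
def thetaSet (l : L.Disc) (ν : N.Disc) : Set W :=
  {m | m ∈ i.perpDual ∧ ∃ (x : L.dual) (y : N.dual),
    Submodule.Quotient.mk x = l ∧ Submodule.Quotient.mk y = ν ∧ m + i.toLin y - x ∈ L.carrier}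

/-- `ϑ_{λ,ν}(τ) = ∑_{m ∈ M', m + ν ∈ λ + L} e(-τ(m,m)/2)`. -/
def theta (l : L.Disc) (ν : N.Disc) (τ : ℍ) : ℂ :=
  ∑' m : i.thetaSet l ν, ee (-τ * (L.form (m : W) m : ℚ) / 2)

/-- `(T_{L,N} f)_ν = ∑_λ ϑ_{λ,ν} f_λ`. -/
def seeSaw (f : ℍ → L.Disc → ℂ) : ℍ → N.Disc → ℂ :=
  fun τ ν => ∑ l : L.Disc, i.theta l ν τ * f τ l

end Inclusion

end EvenLattice

end

open scoped ZMod

noncomputable section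

/-! ### Exponentials and uniqueness of Fourier coefficients -/

/-! Let `P` be the orthogonal sum of `N` and `ℤ` with form `-K s t`, `K` even. Its discriminant
group is `N'/N × ℤ/K`, and the theta functions of the see-saw vanish unless the `N`-components
agree; what remains is the unary series θ_r = ∑ q^{n²/2K} over n ≡ r mod K. So for a tensor product
h = f ⊗ ψ the see-saw returns f · ∑_r ψ_r θ_r (`seeSaw_tensorForm`). It suffices to find ψ of weight
-1/2 for the Weil representation of the rank one lattice, holomorphic on the upper half plane, with
rational coefficients and ∑_r ψ_r θ_r = 1. If moreover ψ_0 vanishes at the cusp to an order larger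
than the pole order of f_0, then h has zero constant term.

Such a ψ comes from Jacobi theta functions. Put ϑ(τ,z) = ∑ χ(n) q^{n²/24} e(nz) with χ the even
primitive character modulo 12. By the pentagonal number theorem ϑ(τ,0) = 2η(τ), which has no zeros
(`thetaSeries_chiC_ne_zero`). For integers a_1, …, a_5 with ∑ a_i² = Q, the quotient ∏ ϑ(τ, a_i z) /
ϑ(τ,0)^5 transforms like a Jacobi form of weight 0 and equals 1 at z = 0. Its theta decomposition
with K = 12Q (`hasSum_perpTheta_mul`) has coefficients ψ_r (`weilVector`) of weight -1/2, and z = 0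
gives ∑ ψ_r θ_r = 1 (`thetaSeries_weilVector`).

The component ψ_0 is a sum over n orthogonal to a with all n_i prime to 6, so its order is at least
min (n,n)/24 - 5/24. Taking a = (A, w, x, y, z) with A = ⌊√Q⌋ and a short remainder from Lagrange's
theorem, orthogonality together with n_0 ≠ 0 forces n to be long (`exists_sum_five_squares`).
Finally Q is taken of the form 6dl², where 2d is the norm of some x in `N`; then 2d(6l)² = 12Q and
(6l x, 1) is isotropic. -/

theorem ee_zero : ee 0 = 1 := by simp [ee]

theorem ee_add (x y : ℂ) : ee (x + y) = ee x * ee y := by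
  rw [ee, ee, ee, mul_add, Complex.exp_add]

theorem ee_neg (x : ℂ) : ee (-x) = (ee x)⁻¹ := by
  rw [ee, ee, mul_neg, Complex.exp_neg]

theorem ee_sub (x y : ℂ) : ee (x - y) = ee x / ee y := by
  rw [sub_eq_add_neg, ee_add, ee_neg, div_eq_mul_inv]

theorem ee_ne_zero (x : ℂ) : ee x ≠ 0 := Complex.exp_ne_zero _

theorem ee_nat_mul (n : ℕ) (x : ℂ) : ee (n * x) = ee x ^ n := by
  rw [ee, ee, ← Complex.exp_nat_mul]; ring_nf

theorem norm_ee (z : ℂ) : ‖ee z‖ = Real.exp (-(2 * Real.pi * z.im)) := by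
  rw [ee, Complex.norm_exp]; congr 1; simp

theorem norm_ee_ofReal (x : ℝ) : ‖ee x‖ = 1 := by simp [norm_ee]

theorem ee_sum {ι : Type*} (s : Finset ι) (g : ι → ℂ) : ee (∑ i ∈ s, g i) = ∏ i ∈ s, ee (g i) := by
  classical
  induction s using Finset.induction_on with
  | empty => simp [ee_zero]
  | insert i s hi ih => rw [Finset.prod_insert hi, Finset.sum_insert hi, ee_add, ih]

theorem ee_eq_one_iff {z : ℂ} : ee z = 1 ↔ ∃ n : ℤ, z = n := by
  rw [ee, Complex.exp_eq_one_iff]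
  have h : (2 * Real.pi * Complex.I : ℂ) ≠ 0 := by simp [Real.pi_ne_zero]
  constructor
  · rintro ⟨n, hn⟩; exact ⟨n, mul_left_cancel₀ h (by rw [hn]; ring)⟩
  · rintro ⟨n, rfl⟩; exact ⟨n, by ring⟩

theorem ee_eq_iff {x y : ℂ} : ee x = ee y ↔ ∃ n : ℤ, x = y + n := by
  rw [← div_eq_one_iff_eq (ee_ne_zero y), ← ee_sub, ee_eq_one_iff]
  simp [sub_eq_iff_eq_add']

theorem norm_ee_lt_one (τ : ℍ) : ‖ee τ‖ < 1 := by
  rw [norm_ee, Real.exp_lt_one_iff]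
  have := τ.im_pos
  have := Real.pi_pos
  simp only [UpperHalfPlane.coe_im, neg_lt_zero]
  positivity

theorem tendsto_average_pow {w : ℂ} (hw : ‖w‖ = 1) (hw1 : w ≠ 1) :
    Filter.Tendsto (fun R : ℕ => (R : ℂ)⁻¹ * ∑ j ∈ Finset.range R, w ^ j) Filter.atTop
      (nhds 0) := by
  rw [tendsto_zero_iff_norm_tendsto_zero]
  have h2 : Filter.Tendsto (fun R : ℕ => (R : ℝ)⁻¹ * (2 / ‖w - 1‖)) Filter.atTop (nhds 0) := by
    simpa using (tendsto_inv_atTop_nhds_zero_nat (𝕜 := ℝ)).mul_const (2 / ‖w - 1‖)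
  refine squeeze_zero (fun _ => norm_nonneg _) (fun R => ?_) h2
  rw [geom_sum_eq hw1, norm_mul, norm_inv, Complex.norm_natCast, norm_div]
  gcongr
  refine (norm_sub_le _ _).trans ?_
  rw [norm_pow, hw]; norm_num

theorem ee_mul_sqrt_two_ne_one {r : ℚ} (hr : r ≠ 0) : ee (r * (Real.sqrt 2 : ℝ)) ≠ 1 := by
  rw [Ne, ee_eq_one_iff]
  rintro ⟨n, hn⟩
  have h : (r : ℝ) * Real.sqrt 2 = n := by exact_mod_cast hn
  exact (irrational_sqrt_two.ratCast_mul hr).ne_int n h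

/-- The coefficients of an absolutely convergent trigonometric series with rational frequencies
are determined by its sum. -/
theorem eq_zero_of_hasSum_ee {a : ℚ → ℂ}
    (h : ∀ x : ℝ, HasSum (fun n : ℚ => a n * ee (n * x)) 0) : a = 0 := by
  have hs : Summable fun n => ‖a n‖ := by
    have := (h 0).summable.norm
    simpa [ee_zero] using this
  funext m
  -- The frequencies have no common denominator, so there is no period to integrate over. Sampling
  -- at j√2 works instead: for n ≠ m the number (n - m)√2 is irrational, so the averages of the
  -- powers of `w n` tend to 0, while `w m = 1`.
  set w : ℚ → ℂ := fun n => ee ((n - m : ℚ) * (Real.sqrt 2 : ℝ)) with hw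
  have hw1 : ∀ n, ‖w n‖ = 1 := fun n => by
    have := norm_ee_ofReal ((n - m : ℚ) * Real.sqrt 2)
    simp only [hw]; push_cast at this ⊢; exact this
  have hpow : ∀ j : ℕ, HasSum (fun n => a n * w n ^ j) 0 := fun j => by
    have := (h (j * Real.sqrt 2)).mul_right (ee (-(m * (j * Real.sqrt 2 : ℝ))))
    rw [zero_mul] at this
    refine this.congr_fun fun n => ?_
    rw [hw, mul_assoc, ← ee_add, ← ee_nat_mul]
    congr 2; push_cast; ring
  have havg : ∀ R : ℕ, HasSum (fun n => a n * ((R : ℂ)⁻¹ * ∑ j ∈ Finset.range R, w n ^ j)) 0 := by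
    intro R
    have := (hasSum_sum fun j (_ : j ∈ Finset.range R) => hpow j).mul_left (R : ℂ)⁻¹
    rw [Finset.sum_const_zero, mul_zero] at this
    refine this.congr_fun fun n => ?_
    rw [Finset.mul_sum, Finset.mul_sum, Finset.mul_sum]
    exact Finset.sum_congr rfl fun _ _ => by ring
  have hlim : Filter.Tendsto (fun R : ℕ => ∑' n, a n * ((R : ℂ)⁻¹ * ∑ j ∈ Finset.range R, w n ^ j))
      Filter.atTop (nhds (∑' n, if n = m then a m else 0)) := by
    refine tendsto_tsum_of_dominated_convergence hs (fun n => ?_) ?_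
    · split_ifs with hn
      · subst hn
        refine Filter.Tendsto.congr' ?_ tendsto_const_nhds
        filter_upwards [Filter.eventually_gt_atTop 0] with R hR
        have : (R : ℂ) ≠ 0 := by exact_mod_cast hR.ne'
        simp [hw, ee_zero, this]
      · have := (tendsto_average_pow (hw1 n)
          (ee_mul_sqrt_two_ne_one (sub_ne_zero.mpr hn))).const_mul (a n)
        simpa using this
    · refine Filter.Eventually.of_forall fun R n => ?_
      rw [norm_mul]
      refine mul_le_of_le_one_right (norm_nonneg _) ?_
      rw [norm_mul, norm_inv, Complex.norm_natCast]
      rcases R.eq_zero_or_pos with rfl | hR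
      · simp
      rw [inv_mul_le_iff₀ (by exact_mod_cast hR), mul_one]
      refine (norm_sum_le _ _).trans ?_
      simp [hw1]
  simp only [fun R => (havg R).tsum_eq, tsum_ite_eq] at hlim
  exact (tendsto_nhds_unique tendsto_const_nhds hlim).symm

theorem eq_zero_of_hasSum_ee_upperHalfPlane {a : ℚ → ℂ}
    (h : ∀ τ : ℍ, HasSum (fun n : ℚ => a n * ee (n * τ)) 0) : a = 0 := by
  -- Restriction to the line Im τ = 1.
  have := eq_zero_of_hasSum_ee (a := fun n => a n * ee (n * Complex.I)) fun x => by
    have := h ⟨x + Complex.I, by simp⟩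
    refine this.congr_fun fun n => ?_
    rw [mul_assoc, ← ee_add, add_comm, ← mul_add]
  funext n
  exact (mul_eq_zero.mp (congrFun this n)).resolve_right (ee_ne_zero _)

theorem eq_zero_of_hasSum_ee_comp {ι : Type*} {x : ι → ℚ} (hx : x.Injective) {a : ι → ℂ}
    (h : ∀ t : ℝ, HasSum (fun i => a i * ee (x i * t)) 0) : a = 0 := by
  have key := eq_zero_of_hasSum_ee (a := Function.extend x a 0) fun t => by
    refine (hx.hasSum_iff fun n hn => ?_).mp ((h t).congr_fun fun i => ?_)
    · rw [Function.extend_apply' _ _ _ hn]; simp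
    · simp [hx.extend_apply]
  funext i
  simpa [hx.extend_apply] using congrFun key (x i)

/-! ### `q`-expansions with rational coefficients -/

/-- `F(τ) = q^α ∑_{k ≥ 0} c_k q^k` with rational `c_k`. -/
def HasQExp (α : ℚ) (F : ℍ → ℂ) : Prop :=
  ∃ c : ℕ → ℚ, ∀ τ : ℍ, HasSum (fun k : ℕ => (c k : ℂ) * ee (((α + k : ℚ) : ℂ) * τ)) (F τ)

theorem ee_add_nat_mul (α : ℚ) (k : ℕ) (τ : ℂ) :
    ee (((α + k : ℚ) : ℂ) * τ) = ee (α * τ) * ee τ ^ k := by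
  rw [← ee_nat_mul, ← ee_add]; congr 1; push_cast; ring

namespace HasQExp

variable {α β : ℚ} {F G : ℍ → ℂ}

theorem one : HasQExp 0 fun _ => 1 :=
  ⟨Pi.single 0 1, fun τ => by
    convert hasSum_single (f := fun k : ℕ => ((Pi.single 0 1 : ℕ → ℚ) k : ℂ) *
      ee (((0 + k : ℚ) : ℂ) * τ)) 0 (fun k hk => by simp [hk]) using 1
    simp [ee_zero]⟩

theorem congr (hF : HasQExp α F) (h : ∀ τ, G τ = F τ) : HasQExp α G :=
  (funext h : G = F) ▸ hF

theorem mul (hF : HasQExp α F) (hG : HasQExp β G) : HasQExp (α + β) fun τ => F τ * G τ := by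
  obtain ⟨c, hc⟩ := hF
  obtain ⟨d, hd⟩ := hG
  refine ⟨fun n => ∑ p ∈ Finset.HasAntidiagonal.antidiagonal n, c p.1 * d p.2, fun τ => ?_⟩
  have h1 := (hc τ).summable.norm
  have h2 := (hd τ).summable.norm
  have := (summable_norm_sum_mul_antidiagonal_of_summable_norm h1 h2).of_norm.hasSum
  rw [← tsum_mul_tsum_eq_tsum_sum_antidiagonal_of_summable_norm h1 h2, (hc τ).tsum_eq,
    (hd τ).tsum_eq] at this
  refine this.congr_fun fun n => ?_
  push_cast
  rw [Finset.sum_mul]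
  refine Finset.sum_congr rfl fun p hp => ?_
  rw [← Finset.HasAntidiagonal.mem_antidiagonal.mp hp, mul_mul_mul_comm, ← ee_add]
  congr 2; push_cast; ring

theorem pow (hF : HasQExp α F) (n : ℕ) : HasQExp (n * α) fun τ => F τ ^ n := by
  induction n with
  | zero => simpa using one
  | succ n ih => simpa [pow_succ, add_mul] using ih.mul hF

end HasQExp

theorem hasSum_ee_pow {α : ℚ} {c : ℕ → ℚ} {τ : ℍ} {x : ℂ}
    (h : HasSum (fun k : ℕ => (c k : ℂ) * ee (((α + k : ℚ) : ℂ) * τ)) x) :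
    HasSum (fun k : ℕ => (c k : ℂ) * ee τ ^ k) ((ee (α * τ))⁻¹ * x) := by
  refine (h.mul_left _).congr_fun fun k => ?_
  rw [ee_add_nat_mul]
  field_simp [ee_ne_zero]

theorem exists_ee_eq {q : ℂ} (hq : q ≠ 0) (hq1 : ‖q‖ < 1) : ∃ τ : ℍ, ee τ = q := by
  have hπ : (2 * Real.pi * Complex.I : ℂ) ≠ 0 := by simp [Real.pi_ne_zero]
  have he : ee (Complex.log q / (2 * Real.pi * Complex.I)) = q := by
    rw [ee, mul_div_cancel₀ _ hπ, Complex.exp_log hq]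
  refine ⟨⟨Complex.log q / (2 * Real.pi * Complex.I), ?_⟩, he⟩
  rw [← he, norm_ee, Real.exp_lt_one_iff, neg_lt_zero] at hq1
  exact (mul_pos_iff_of_pos_left (by have := Real.pi_pos; positivity)).mp hq1

/-- If a power series converges at all `e(τ)`, it is holomorphic on the unit disc. -/
theorem differentiableOn_tsum_pow {c : ℕ → ℚ}
    (h : ∀ τ : ℍ, Summable (fun k : ℕ => (c k : ℂ) * ee τ ^ k)) :
    DifferentiableOn ℂ (fun q : ℂ => ∑' k : ℕ, (c k : ℂ) * q ^ k) (Metric.ball 0 1) := by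
  intro q hq
  obtain ⟨r, hr, hr1⟩ := exists_between (mem_ball_zero_iff.mp hq)
  have hr0 : 0 < r := (norm_nonneg q).trans_lt hr
  -- Convergence at the real point r > |q| gives a uniform majorant on the disc of radius r.
  obtain ⟨τ, hτ⟩ := exists_ee_eq (q := (r : ℂ)) (by exact_mod_cast hr0.ne')
    (by simpa [abs_of_pos hr0] using hr1)
  have hs := (h τ).norm
  rw [hτ] at hs
  refine DifferentiableAt.differentiableWithinAt ?_
  refine (Complex.differentiableOn_tsum_of_summable_norm (U := Metric.ball 0 r) hs (fun i => ?_)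
    Metric.isOpen_ball fun i w hw => ?_).differentiableAt
    (Metric.isOpen_ball.mem_nhds (mem_ball_zero_iff.mpr hr))
  · fun_prop
  · rw [norm_mul, norm_mul, norm_pow, norm_pow]
    gcongr
    simpa [abs_of_pos hr0] using (mem_ball_zero_iff.mp hw).le

namespace HasQExp

variable {α β : ℚ} {F G : ℍ → ℂ}

theorem mdifferentiable (hF : HasQExp α F) : MDiff F := by
  obtain ⟨c, hc⟩ := hF
  have hd := differentiableOn_tsum_pow fun τ => (hasSum_ee_pow (hc τ)).summable
  rw [UpperHalfPlane.mdifferentiable_iff]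
  have hee : Differentiable ℂ ee := by unfold ee; fun_prop
  have : DifferentiableOn ℂ (fun z : ℂ => ee (α * z) * ∑' k : ℕ, (c k : ℂ) * ee z ^ k)
      UpperHalfPlane.upperHalfPlaneSet := by
    refine DifferentiableOn.mul ?_ (hd.comp hee.differentiableOn fun z hz => ?_)
    · exact (hee.comp (differentiable_id.const_mul _)).differentiableOn
    · exact mem_ball_zero_iff.mpr (norm_ee_lt_one ⟨z, hz⟩)
  refine this.congr fun z hz => ?_
  rw [Function.comp_apply, UpperHalfPlane.ofComplex_apply_of_im_pos hz]
  have := (hasSum_ee_pow (hc ⟨z, hz⟩)).tsum_eq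
  dsimp only at this ⊢
  rw [this, mul_inv_cancel_left₀ (ee_ne_zero _)]

/-- A series indexed by an arbitrary type, with finitely many terms for each exponent. -/
theorem of_hasSum {ι : Type*} {x w : ι → ℚ} (hx : ∀ i, ∃ k : ℕ, x i = α + k)
    (hfin : ∀ k : ℕ, {i | x i = α + k}.Finite)
    (h : ∀ τ : ℍ, HasSum (fun i => (w i : ℂ) * ee (x i * τ)) (F τ)) : HasQExp α F := by
  choose e he using hx
  have hfin' : ∀ k, Finite {i // e i = k} := fun k => by
    refine ((hfin k).subset fun i hi => ?_).to_subtype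
    rw [Set.mem_ofPred_eq, he i, show e i = k from hi]
  have : ∀ k, Fintype {i // e i = k} := fun k => Fintype.ofFinite _
  refine ⟨fun k => ∑ i : {i // e i = k}, w i, fun τ => ?_⟩
  have h1 := (Equiv.sigmaFiberEquiv e).hasSum_iff.mpr (h τ)
  refine (h1.sigma fun k => hasSum_fintype _).congr_fun fun k => ?_
  rw [Rat.cast_sum, Finset.sum_mul]
  refine Finset.sum_congr rfl fun i _ => ?_
  simp only [Function.comp_apply, Equiv.sigmaFiberEquiv_apply]
  rw [he i, i.2]

theorem hasSum_unique {c d : ℕ → ℂ} {F : ℍ → ℂ}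
    (hc : ∀ τ : ℍ, HasSum (fun k : ℕ => c k * ee τ ^ k) (F τ))
    (hd : ∀ τ : ℍ, HasSum (fun k : ℕ => d k * ee τ ^ k) (F τ)) : c = d := by
  have hinj : Function.Injective (fun k : ℕ => (k : ℚ)) := Nat.cast_injective
  have key := eq_zero_of_hasSum_ee_upperHalfPlane
    (a := Function.extend (fun k : ℕ => (k : ℚ)) (fun k => c k - d k) 0) fun τ => by
      refine (hinj.hasSum_iff fun n hn => ?_).mp ?_
      · rw [Function.extend_apply' _ _ _ hn]; simp
      · have := (hc τ).sub (hd τ)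
        rw [sub_self] at this
        refine this.congr_fun fun k => ?_
        rw [Function.comp_apply, hinj.extend_apply]
        push_cast
        rw [ee_nat_mul, sub_mul]
  funext k
  have := congrFun key k
  rw [hinj.extend_apply] at this
  exact sub_eq_zero.mp this

/-- After removing q^α the power series has no zero in the unit disc: its value at 0 is c_0, and
elsewhere it is a nonzero multiple of `F`. Hence its reciprocal is holomorphic there and equals its
Taylor series. By uniqueness of coefficients that series is the formal inverse, which is defined
over ℚ. -/
theorem inv {c : ℕ → ℚ}
    (hc : ∀ τ : ℍ, HasSum (fun k : ℕ => (c k : ℂ) * ee (((α + k : ℚ) : ℂ) * τ)) (F τ))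
    (hc0 : c 0 ≠ 0) (hF : ∀ τ, F τ ≠ 0) : HasQExp (-α) fun τ => (F τ)⁻¹ := by
  have hs := fun τ => hasSum_ee_pow (hc τ)
  set E : ℂ → ℂ := fun q => ∑' k : ℕ, (c k : ℂ) * q ^ k with hE
  have hEτ : ∀ τ : ℍ, E (ee τ) = (ee (α * τ))⁻¹ * F τ := fun τ => (hs τ).tsum_eq
  have hd : DifferentiableOn ℂ E (Metric.ball 0 1) :=
    differentiableOn_tsum_pow fun τ => (hs τ).summable
  have hE0 : ∀ q ∈ Metric.ball (0 : ℂ) 1, E q ≠ 0 := by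
    intro q hq
    rcases eq_or_ne q 0 with rfl | hq0
    · simp only [hE]
      rw [tsum_eq_single 0 fun k hk => by simp [hk]]
      simpa using hc0
    · obtain ⟨τ, rfl⟩ := exists_ee_eq hq0 (mem_ball_zero_iff.mp hq)
      rw [hEτ]
      exact mul_ne_zero (inv_ne_zero (ee_ne_zero _)) (hF τ)
  obtain ⟨b, hb⟩ : ∃ b : ℕ → ℂ, ∀ τ : ℍ, HasSum (fun k => b k * ee τ ^ k) (E (ee τ))⁻¹ := by
    refine ⟨fun k => ((k.factorial : ℂ)⁻¹) * iteratedDeriv k (fun q => (E q)⁻¹) 0, fun τ => ?_⟩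
    have := Complex.hasSum_taylorSeries_on_ball (hd.fun_inv hE0)
      (mem_ball_zero_iff.mpr (norm_ee_lt_one τ))
    refine this.congr_fun fun k => ?_
    simp only [smul_eq_mul, sub_zero]; ring
  have hmul : PowerSeries.mk (fun k => (c k : ℂ)) * PowerSeries.mk b = 1 := by
    ext n
    have := hasSum_unique (c := fun n => PowerSeries.coeff n
        (PowerSeries.mk (fun k => (c k : ℂ)) * PowerSeries.mk b))
      (d := fun n => PowerSeries.coeff n (1 : PowerSeries ℂ)) (F := fun _ => 1)
      (fun τ => ?_) (fun τ => ?_)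
    · exact congrFun this n
    · have h1 := (hs τ).summable.norm
      have h2 := (hb τ).summable.norm
      have := (summable_norm_sum_mul_antidiagonal_of_summable_norm h1 h2).of_norm.hasSum
      rw [← tsum_mul_tsum_eq_tsum_sum_antidiagonal_of_summable_norm h1 h2, (hb τ).tsum_eq,
        (hs τ).tsum_eq, ← hEτ, mul_inv_cancel₀ (hE0 _ (mem_ball_zero_iff.mpr (norm_ee_lt_one τ)))]
        at this
      refine this.congr_fun fun n => ?_
      rw [PowerSeries.coeff_mul, Finset.sum_mul]
      refine Finset.sum_congr rfl fun p hp => ?_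
      rw [← Finset.HasAntidiagonal.mem_antidiagonal.mp hp]
      simp only [PowerSeries.coeff_mk]
      ring
    · convert hasSum_single (f := fun k : ℕ => PowerSeries.coeff k (1 : PowerSeries ℂ) *
        ee τ ^ k) 0 (fun k hk => by simp [PowerSeries.coeff_one, hk]) using 1
      simp
  have hinv : PowerSeries.mk b = PowerSeries.map (algebraMap ℚ ℂ) (PowerSeries.mk c)⁻¹ := by
    have h1 : PowerSeries.mk c * (PowerSeries.mk c)⁻¹ = 1 :=
      PowerSeries.mul_inv_cancel _ (by simpa using hc0)
    have h2 := congrArg (PowerSeries.map (algebraMap ℚ ℂ)) h1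
    rw [map_mul, map_one] at h2
    have h3 : PowerSeries.map (algebraMap ℚ ℂ) (PowerSeries.mk c) =
        PowerSeries.mk (fun k => (c k : ℂ)) := by ext; simp
    rw [h3] at h2
    exact (left_inv_eq_right_inv (by rw [mul_comm]; exact hmul) h2)
  refine ⟨fun k => PowerSeries.coeff k (PowerSeries.mk c)⁻¹, fun τ => ?_⟩
  have := (hb τ).mul_left (ee (-(α * τ)))
  rw [hEτ, mul_inv, inv_inv, ← mul_assoc, ← ee_add, neg_add_cancel, ee_zero, one_mul] at this
  refine this.congr_fun fun k => ?_
  have hk := congrArg (PowerSeries.coeff k) hinv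
  rw [PowerSeries.coeff_mk, PowerSeries.coeff_map] at hk
  rw [hk, ee_add_nat_mul]
  simp only [eq_ratCast]
  push_cast
  rw [neg_mul]
  ring

end HasQExp

section

/-! ### Jacobi theta functions attached to functions on `ℤ/K` -/

/-- `∑_n c(n) e(n²τ/2K + nz)`. -/
def thetaSeries (K : ℕ) (c : ZMod K → ℂ) (τ : ℍ) (z : ℂ) : ℂ :=
  ∑' n : ℤ, c n * ee ((n : ℂ) ^ 2 / (2 * K) * τ + n * z)

variable {K : ℕ} [NeZero K]

theorem ee_eq_jacobiTheta₂_term (τ z : ℂ) (n : ℤ) :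
    ee ((n : ℂ) ^ 2 / (2 * K) * τ + n * z) = jacobiTheta₂_term n z (τ / K) := by
  have : (K : ℂ) ≠ 0 := NeZero.ne _
  rw [ee, jacobiTheta₂_term]; congr 1; field_simp; ring

theorem im_div_natCast_pos (τ : ℍ) : 0 < ((τ : ℂ) / K).im := by
  rw [Complex.div_natCast_im]
  exact div_pos τ.im_pos (by exact_mod_cast NeZero.pos K)

theorem summable_norm_ee_sq (τ : ℍ) (z : ℂ) :
    Summable fun n : ℤ => ‖ee ((n : ℂ) ^ 2 / (2 * K) * τ + n * z)‖ := by
  simp only [ee_eq_jacobiTheta₂_term]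
  exact ((summable_jacobiTheta₂_term_iff _ _).mpr (im_div_natCast_pos τ)).norm

theorem summable_norm_thetaSeries (c : ZMod K → ℂ) (τ : ℍ) (z : ℂ) :
    Summable fun n : ℤ => ‖c n * ee ((n : ℂ) ^ 2 / (2 * K) * τ + n * z)‖ := by
  obtain ⟨M, hM⟩ := (Set.finite_range fun r => ‖c r‖).bddAbove
  refine ((summable_norm_ee_sq (K := K) τ z).mul_left M).of_nonneg_of_le
    (fun _ => norm_nonneg _) fun n => ?_
  rw [norm_mul]
  gcongr
  exact hM ⟨_, rfl⟩

theorem hasSum_thetaSeries (c : ZMod K → ℂ) (τ : ℍ) (z : ℂ) :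
    HasSum (fun n : ℤ => c n * ee ((n : ℂ) ^ 2 / (2 * K) * τ + n * z)) (thetaSeries K c τ z) :=
  (summable_norm_thetaSeries c τ z).of_norm.hasSum

theorem thetaSeries_smul (x : ℂ) (c : ZMod K → ℂ) (τ : ℍ) (z : ℂ) :
    thetaSeries K (fun r => x * c r) τ z = x * thetaSeries K c τ z :=
  (((hasSum_thetaSeries c τ z).mul_left x).congr_fun fun _ => by ring).tsum_eq

theorem thetaSeries_eq_sum (c : ZMod K → ℂ) (τ : ℍ) (z : ℂ) :
    thetaSeries K c τ z = ∑ r, c r * thetaSeries K (Pi.single r 1) τ z := by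
  have := hasSum_sum fun r (_ : r ∈ Finset.univ) =>
    (hasSum_thetaSeries (K := K) (Pi.single r 1) τ z).mul_left (c r)
  refine (this.congr_fun fun n => ?_).tsum_eq
  rw [Finset.sum_eq_single (n : ZMod K)]
  · simp
  · intro r _ hr
    rw [Pi.single_eq_of_ne hr.symm]; ring
  · simp

/-- The theta series with `z` varying determines its coefficients. -/
theorem thetaSeries_injective {c d : ZMod K → ℂ} {τ : ℍ}
    (h : ∀ z, thetaSeries K c τ z = thetaSeries K d τ z) : c = d := by
  have key := eq_zero_of_hasSum_ee_comp (x := fun n : ℤ => (n : ℚ)) Int.cast_injective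
    (a := fun n : ℤ => (c n - d n) * ee ((n : ℂ) ^ 2 / (2 * K) * τ)) fun t => by
      have := (hasSum_thetaSeries c τ t).sub (hasSum_thetaSeries d τ t)
      rw [h, sub_self] at this
      refine this.congr_fun fun n => ?_
      rw [ee_add]; push_cast; ring
  funext r
  obtain ⟨n, rfl⟩ := ZMod.intCast_surjective r
  exact sub_eq_zero.mp ((mul_eq_zero.mp (congrFun key n)).resolve_right (ee_ne_zero _))

theorem stdAddChar_eq_ee (n : ℤ) : ZMod.stdAddChar (n : ZMod K) = ee (n / K) := by
  rw [ZMod.stdAddChar_coe, ee]; congr 1; ring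

/-- The number `√(-iτ)`. -/
def sqrtNegI (τ : ℍ) : ℂ := (-Complex.I * τ) ^ (1 / 2 : ℂ)

theorem hasSum_residue_class {g : ℤ → ℂ} {x : ℂ} (r : ℤ)
    (h : HasSum (fun k : ℤ => g (r + K * k)) x) :
    HasSum (fun n : ℤ => if (n : ZMod K) = (r : ZMod K) then g n else 0) x := by
  have hinj : Function.Injective fun k : ℤ => r + K * k := fun a b hab => by
    simpa [NeZero.ne K] using hab
  refine (hinj.hasSum_iff fun n hn => ?_).mp (h.congr_fun fun k => ?_)
  · rw [if_neg]
    intro hnr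
    obtain ⟨k, hk⟩ := (ZMod.intCast_eq_intCast_iff_dvd_sub _ _ _).mp hnr.symm
    exact hn ⟨k, by dsimp only; rw [← hk]; ring⟩
  · simp

theorem re_neg_I_mul_pos (τ : ℍ) : 0 < (-Complex.I * τ).re := by
  simpa using τ.im_pos

theorem neg_I_mul_ne_zero (τ : ℍ) : -Complex.I * (τ : ℂ) ≠ 0 := by
  simp [τ.ne_zero]

/-- A positive real factor leaves the argument unchanged, so it can be taken out of the principal
root. -/
theorem neg_I_mul_div_cpow (τ : ℍ) :
    (-Complex.I * (τ / K)) ^ (1 / 2 : ℂ) = sqrtNegI τ / (Real.sqrt K : ℝ) := by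
  have hK : 0 < (K : ℝ)⁻¹ := inv_pos.mpr (by exact_mod_cast NeZero.pos K)
  have h : -Complex.I * ((τ : ℂ) / K) = (((K : ℝ)⁻¹ : ℝ) : ℂ) * (-Complex.I * τ) := by
    push_cast; ring
  have hne := neg_I_mul_ne_zero τ
  have hKC : (((K : ℝ)⁻¹ : ℝ) : ℂ) ≠ 0 := by exact_mod_cast hK.ne'
  rw [h, Complex.cpow_def_of_ne_zero (mul_ne_zero hKC hne), Complex.log_ofReal_mul hK hne, add_mul,
    Complex.exp_add, sqrtNegI, Complex.cpow_def_of_ne_zero hne, mul_comm, div_eq_mul_inv]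
  congr 1
  rw [← Complex.ofReal_inv, ← Real.sqrt_inv, Real.sqrt_eq_rpow, Real.rpow_def_of_pos hK]
  push_cast
  rfl

theorem sqrtNegI_ne_zero (τ : ℍ) : sqrtNegI τ ≠ 0 := by
  rw [sqrtNegI, Ne, Complex.cpow_eq_zero_iff]
  exact fun h => neg_I_mul_ne_zero τ h.1

theorem coe_S_smul (τ : ℍ) : ((ModularGroup.S • τ : ℍ) : ℂ) = -1 / τ := by
  rw [UpperHalfPlane.modular_S_smul, UpperHalfPlane.coe_mk, ← neg_inv, neg_div, one_div]

theorem sqrtNegI_S_smul (τ : ℍ) : sqrtNegI (ModularGroup.S • τ) = (sqrtNegI τ)⁻¹ := by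
  rw [sqrtNegI, sqrtNegI, coe_S_smul, ← Complex.inv_cpow]
  · congr 1
    rw [mul_inv, inv_neg, Complex.inv_I]; ring
  · rw [Ne, Complex.arg_eq_pi_iff]
    exact fun h => (re_neg_I_mul_pos τ).not_gt h.1

/-- Split the left side by residue classes. The functional equation of `jacobiTheta₂` turns the
class of r into a theta series shifted by r/K, whose n-th term carries e(-rn/K); summing over r
against `c` produces the discrete Fourier transform. -/
theorem thetaSeries_S_smul (c : ZMod K → ℂ) (τ : ℍ) (z : ℂ) :
    thetaSeries K c (ModularGroup.S • τ) (z / τ) =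
      sqrtNegI τ / (Real.sqrt K : ℝ) * ee (K * z ^ 2 / (2 * τ)) * thetaSeries K (𝓕 c) τ z := by
  have hτ : (τ : ℂ) ≠ 0 := τ.ne_zero
  have hK : (K : ℂ) ≠ 0 := NeZero.ne _
  have h1 : ∀ r : ZMod K, HasSum (fun n : ℤ => if (n : ZMod K) = r then
      ee ((n : ℂ) ^ 2 / (2 * K) * (ModularGroup.S • τ : ℍ) + n * (z / τ)) else 0)
      (sqrtNegI τ / (Real.sqrt K : ℝ) * ee (K * z ^ 2 / (2 * τ)) *
        jacobiTheta₂ (z - r.val / K) (τ / K)) := by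
    intro r
    have hr : ((r.val : ℤ) : ZMod K) = r := by simp
    have := hasSum_residue_class (K := K) (r := r.val) (x := sqrtNegI τ / (Real.sqrt K : ℝ) * ee (K * z ^ 2 / (2 * τ)) *
        jacobiTheta₂ (z - r.val / K) (τ / K))
      (g := fun n => ee ((n : ℂ) ^ 2 / (2 * K) * (ModularGroup.S • τ : ℍ) + n * (z / τ))) ?_
    · rwa [hr] at this
    rw [jacobiTheta₂_functional_equation, neg_I_mul_div_cpow]
    have hi : 0 < (-1 / ((τ : ℂ) / K)).im := by
      have := (ModularGroup.S • (⟨τ / K, im_div_natCast_pos τ⟩ : ℍ)).im_pos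
      rwa [← UpperHalfPlane.coe_im, coe_S_smul] at this
    have hs := (hasSum_jacobiTheta₂_term ((z - r.val / K) / (τ / K)) hi).mul_left
      (sqrtNegI τ / (Real.sqrt K : ℝ) * ee (K * z ^ 2 / (2 * τ)) * (1 / (sqrtNegI τ / (Real.sqrt K : ℝ)) *
        Complex.exp (-Real.pi * Complex.I * (z - r.val / K) ^ 2 / (τ / K))))
    have hsq : sqrtNegI τ / (Real.sqrt K : ℝ) ≠ 0 := by
      refine div_ne_zero (sqrtNegI_ne_zero τ) ?_
      have : 0 < Real.sqrt K := Real.sqrt_pos.mpr (by exact_mod_cast NeZero.pos K)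
      exact_mod_cast this.ne'
    rw [← mul_assoc (_ * _) (_ * _)]
    refine hs.congr_fun fun k => ?_
    · rw [jacobiTheta₂_term, coe_S_smul, ee, ee]
      generalize sqrtNegI τ / (Real.sqrt K : ℝ) = s at hsq
      rw [show ∀ A B C : ℂ, s * A * (1 / s * B) * C = A * B * C by intros; field_simp,
        ← Complex.exp_add, ← Complex.exp_add]
      congr 1
      push_cast
      field_simp
      ring
  have h2 : ∀ r : ZMod K, HasSum (fun n : ℤ => ee (-(r.val * n : ℤ) / K) *
      ee ((n : ℂ) ^ 2 / (2 * K) * τ + n * z)) (jacobiTheta₂ (z - r.val / K) (τ / K)) := by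
    intro r
    refine (hasSum_jacobiTheta₂_term (z - r.val / K) (im_div_natCast_pos (K := K) τ)).congr_fun
      fun n => ?_
    rw [← ee_eq_jacobiTheta₂_term, ← ee_add]
    congr 1; push_cast; field_simp; ring
  have h3 : thetaSeries K (𝓕 c) τ z = ∑ r, c r * jacobiTheta₂ (z - r.val / K) (τ / K) := by
    refine ((hasSum_sum fun r _ => (h2 r).mul_left (c r)).congr_fun fun n => ?_).tsum_eq
    rw [ZMod.dft_apply, Finset.sum_mul]
    refine Finset.sum_congr rfl fun r _ => ?_
    have : -(r * (n : ZMod K)) = ((-(r.val * n) : ℤ) : ZMod K) := by push_cast; simp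
    rw [this, stdAddChar_eq_ee, smul_eq_mul]
    push_cast; ring
  rw [h3, Finset.mul_sum]
  refine ((hasSum_sum fun r _ => (h1 r).mul_left (c r)).congr_fun fun n => ?_).tsum_eq.trans
    (Finset.sum_congr rfl fun r _ => by ring)
  simp

end

/-! ### The even character modulo 12 and its theta series -/

/-- The primitive even Dirichlet character modulo 12. -/
def chi (r : ZMod 12) : ℚ :=
  if r = 1 ∨ r = 11 then 1 else if r = 5 ∨ r = 7 then -1 else 0

/-- The complex valued function `chi`. -/
def chiC (r : ZMod 12) : ℂ := (chi r : ℂ)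

theorem chi_neg (r : ZMod 12) : chi (-r) = chi r := by
  revert r; decide

theorem sq_eq_one_of_chi_ne_zero (r : ZMod 12) (h : chi r ≠ 0) :
    r = 1 ∨ r = 5 ∨ r = 7 ∨ r = 11 := by
  revert r; decide

theorem exists_eq_of_chi_ne_zero {n : ℤ} (h : chi n ≠ 0) :
    ∃ j : ℤ, n = 6 * j - 1 ∨ n = -(6 * j - 1) := by
  have key : ∀ a : ℤ, (n : ZMod 12) = (a : ZMod 12) → ∃ j : ℤ, n = a + 12 * j := by
    intro a ha
    obtain ⟨j, hj⟩ := (ZMod.intCast_eq_intCast_iff_dvd_sub _ _ _).mp ha.symm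
    exact ⟨j, by push_cast at hj; linarith⟩
  rcases sq_eq_one_of_chi_ne_zero _ h with h2 | h2 | h2 | h2
  · obtain ⟨j, rfl⟩ := key 1 (by simpa using h2)
    exact ⟨-2 * j, Or.inr (by ring)⟩
  · obtain ⟨j, rfl⟩ := key 5 (by simpa using h2)
    exact ⟨2 * j + 1, Or.inl (by ring)⟩
  · obtain ⟨j, rfl⟩ := key 7 (by simpa using h2)
    exact ⟨-2 * j - 1, Or.inr (by ring)⟩
  · obtain ⟨j, rfl⟩ := key 11 (by simpa using h2)
    exact ⟨2 * j + 2, Or.inl (by ring)⟩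

/-- (6j - 1)² = 1 + 24 · j(3j - 1)/2, and the last factor is a pentagonal number. -/
theorem exists_sq_eq_of_chi_ne_zero {n : ℤ} (h : chi n ≠ 0) : ∃ k : ℤ, n ^ 2 = 1 + 24 * k := by
  obtain ⟨j, hj⟩ := exists_eq_of_chi_ne_zero h
  have h1 : n ^ 2 = 1 + 24 * pentagonal j := by
    have := two_mul_natCast_pentagonal j
    rcases hj with rfl | rfl <;> linear_combination (-12) * this
  exact ⟨_, h1⟩

theorem chi_six_mul_sub_one (j : ℤ) : chi ((6 * j - 1 : ℤ) : ZMod 12) = (j.negOnePow : ℤ) := by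
  have h12 : (12 : ZMod 12) = 0 := rfl
  rcases Int.even_or_odd j with hj | hj
  · rw [Int.negOnePow_even _ hj]
    obtain ⟨i, rfl⟩ := hj
    rw [show ((6 * (i + i) - 1 : ℤ) : ZMod 12) = 11 by
      push_cast; linear_combination ((i : ZMod 12) - 1) * h12]
    rfl
  · rw [Int.negOnePow_odd _ hj]
    obtain ⟨i, rfl⟩ := hj
    rw [show ((6 * (2 * i + 1) - 1 : ℤ) : ZMod 12) = 5 by
      push_cast; linear_combination (i : ZMod 12) * h12]
    rfl

theorem ee_one_div_twelve : ee (1 / 12) = ((Real.sqrt 3 : ℝ) + Complex.I) / 2 := by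
  have : (2 * Real.pi * Complex.I * (1 / 12) : ℂ) = ((Real.pi / 6 : ℝ) : ℂ) * Complex.I := by
    push_cast; ring
  rw [ee, this, Complex.exp_mul_I, ← Complex.ofReal_cos, ← Complex.ofReal_sin, Real.cos_pi_div_six,
    Real.sin_pi_div_six]
  push_cast; ring

theorem stdAddChar_twelve (r : ZMod 12) :
    ZMod.stdAddChar r = (((Real.sqrt 3 : ℝ) + Complex.I) / 2) ^ r.val := by
  rw [← ee_one_div_twelve, ← ee_nat_mul]
  have := stdAddChar_eq_ee (K := 12) (r.val : ℤ)
  rw [show (((r.val : ℤ) : ZMod 12)) = r by simp] at this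
  rw [this]; congr 1; push_cast; ring

/-- A real even primitive character is an eigenvector of the Fourier transform, with Gauss sum √12.
Here this is verified for each of the twelve residues from the powers of the root of unity (√3 +
i)/2. -/
theorem dft_chiC : 𝓕 chiC = fun r => 2 * (Real.sqrt 3 : ℝ) * chiC r := by
  funext k
  have hsum : ∀ g : ZMod 12 → ℂ, ∑ j, g j * chiC j = g 1 - g 5 - g 7 + g 11 := by
    intro g
    have : (Finset.univ : Finset (ZMod 12)) = {0, 1, 2, 3, 4, 5, 6, 7, 8, 9, 10, 11} := by decide
    rw [this]
    have e : ∀ r : ZMod 12, chiC r = ((chi r : ℚ) : ℂ) := fun _ => rfl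
    repeat rw [Finset.sum_insert (by decide)]
    rw [Finset.sum_singleton]
    simp only [e, show chi 0 = 0 by decide, show chi 1 = 1 by decide, show chi 2 = 0 by decide,
      show chi 3 = 0 by decide, show chi 4 = 0 by decide, show chi 5 = -1 by decide,
      show chi 6 = 0 by decide, show chi 7 = -1 by decide, show chi 8 = 0 by decide,
      show chi 9 = 0 by decide, show chi 10 = 0 by decide, show chi 11 = 1 by decide]
    push_cast; ring
  rw [ZMod.dft_apply]
  simp only [smul_eq_mul]
  rw [hsum fun j => ZMod.stdAddChar (-(j * k))]
  simp only [stdAddChar_twelve]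
  have h3 : ((Real.sqrt 3 : ℝ) : ℂ) ^ 2 = 3 := by
    rw [← Complex.ofReal_pow, Real.sq_sqrt (by norm_num)]; norm_num
  generalize ((Real.sqrt 3 : ℝ) : ℂ) = s at h3
  have hI := Complex.I_sq
  generalize Complex.I = i at hI
  have e2 : ((s + i) / 2) ^ 2 = (1 + s * i) / 2 := by linear_combination h3 / 4 + hI / 4
  have e3 : ((s + i) / 2) ^ 3 = i := by
    rw [pow_succ, e2]; linear_combination i * h3 / 4 + s * hI / 4
  have e4 : ((s + i) / 2) ^ 4 = (s * i - 1) / 2 := by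
    rw [pow_succ, e3]; linear_combination hI / 2
  have e5 : ((s + i) / 2) ^ 5 = (i - s) / 2 := by
    rw [pow_add _ 3 2, e3, e2]; linear_combination s * hI / 2
  have e6 : ((s + i) / 2) ^ 6 = -1 := by
    rw [pow_add _ 3 3, e3]; linear_combination hI
  have e7 : ((s + i) / 2) ^ 7 = -(s + i) / 2 := by rw [pow_succ, e6]; ring
  have e8 : ((s + i) / 2) ^ 8 = -(1 + s * i) / 2 := by rw [pow_add _ 6 2, e6, e2]; ring
  have e9 : ((s + i) / 2) ^ 9 = -i := by rw [pow_add _ 6 3, e6, e3]; ring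
  have e10 : ((s + i) / 2) ^ 10 = (1 - s * i) / 2 := by rw [pow_add _ 6 4, e6, e4]; ring
  have e11 : ((s + i) / 2) ^ 11 = (s - i) / 2 := by rw [pow_add _ 6 5, e6, e5]; ring
  obtain ⟨k, hk⟩ := k
  generalize hw : (s + i) / 2 = w at *
  -- The four exponents are -k, -5k, -7k, -11k reduced modulo 12, and `x` is χ(k).
  have hval : ∀ a b c d : ℕ, ∀ x : ℚ, ∀ r : ZMod 12, (-(1 * r)).val = a → (-(5 * r)).val = b →
      (-(7 * r)).val = c → (-(11 * r)).val = d → chi r = x →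
      w ^ a - w ^ b - w ^ c + w ^ d = 2 * s * (x : ℂ) →
      w ^ (-(1 * r)).val - w ^ (-(5 * r)).val - w ^ (-(7 * r)).val + w ^ (-(11 * r)).val =
        2 * s * chiC r := by
    rintro _ _ _ _ _ r rfl rfl rfl rfl rfl h
    exact h
  interval_cases k
  · refine hval 0 0 0 0 0 0 rfl rfl rfl rfl rfl (by simp)
  · refine hval 11 7 5 1 1 1 rfl rfl rfl rfl rfl ?_
    rw [e11, e7, e5, ← hw]; push_cast; ring
  · refine hval 10 2 10 2 0 2 rfl rfl rfl rfl rfl (by push_cast; ring)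
  · refine hval 9 9 3 3 0 3 rfl rfl rfl rfl rfl (by push_cast; ring)
  · refine hval 8 4 8 4 0 4 rfl rfl rfl rfl rfl (by push_cast; ring)
  · refine hval 7 11 1 5 (-1) 5 rfl rfl rfl rfl rfl ?_
    rw [e11, e7, e5, ← hw]; push_cast; ring
  · refine hval 6 6 6 6 0 6 rfl rfl rfl rfl rfl (by push_cast; ring)
  · refine hval 5 1 11 7 (-1) 7 rfl rfl rfl rfl rfl ?_
    rw [e11, e7, e5, ← hw]; push_cast; ring
  · refine hval 4 8 4 8 0 8 rfl rfl rfl rfl rfl (by push_cast; ring)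
  · refine hval 3 3 9 9 0 9 rfl rfl rfl rfl rfl (by push_cast; ring)
  · refine hval 2 10 2 10 0 10 rfl rfl rfl rfl rfl (by push_cast; ring)
  · refine hval 1 5 7 11 1 11 rfl rfl rfl rfl rfl ?_
    rw [e11, e7, e5, ← hw]; push_cast; ring

/-- The eigenvalue 2√3 of the Fourier transform cancels the factor 1/√12, so ϑ is carried to itself.
-/
theorem thetaSeries_chiC_S_smul (τ : ℍ) (z : ℂ) :
    thetaSeries 12 chiC (ModularGroup.S • τ) (z / τ) =
      sqrtNegI τ * ee (6 * z ^ 2 / τ) * thetaSeries 12 chiC τ z := by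
  have h12 : Real.sqrt (12 : ℕ) = 2 * Real.sqrt 3 := by
    rw [show ((12 : ℕ) : ℝ) = 2 ^ 2 * 3 by norm_num, Real.sqrt_mul (by norm_num),
      Real.sqrt_sq (by norm_num)]
  have h3 : ((Real.sqrt 3 : ℝ) : ℂ) ≠ 0 := by
    have : 0 < Real.sqrt 3 := Real.sqrt_pos.mpr (by norm_num)
    exact_mod_cast this.ne'
  have hτ := τ.ne_zero
  rw [thetaSeries_S_smul, dft_chiC, thetaSeries_smul, h12]
  have : ((12 : ℕ) : ℂ) * z ^ 2 / (2 * τ) = 6 * z ^ 2 / τ := by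
    push_cast; field_simp; ring
  rw [this]
  push_cast
  field_simp

/-! ### The pentagonal number theorem -/

theorem norm_prod_one_sub_pow_le {q : ℂ} (hq : ‖q‖ < 1) (k n : ℕ) :
    ‖∏ i ∈ Finset.range (n + 1), (1 - q ^ (k + i + 1))‖ ≤ Real.exp (1 - ‖q‖)⁻¹ := by
  rw [norm_prod]
  calc ∏ i ∈ Finset.range (n + 1), ‖1 - q ^ (k + i + 1)‖
      ≤ ∏ i ∈ Finset.range (n + 1), (1 + ‖q‖ ^ i) := by
        refine Finset.prod_le_prod (fun _ _ => norm_nonneg _) fun i _ => ?_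
        refine (norm_sub_le _ _).trans ?_
        rw [norm_one, norm_pow]
        gcongr 1 + ?_
        exact pow_le_pow_of_le_one (norm_nonneg _) hq.le (by omega)
    _ ≤ Real.exp (∑ i ∈ Finset.range (n + 1), ‖q‖ ^ i) :=
        Real.prod_one_add_le_exp_sum _ fun i => by positivity
    _ ≤ _ := by
        rw [Real.exp_le_exp, ← tsum_geometric_of_lt_one (norm_nonneg _) hq]
        exact (summable_geometric_of_lt_one (norm_nonneg _) hq).sum_le_tsum _
          fun _ _ => by positivity

/-- Only the convergence hypotheses of `Pentagonal.tprod_one_sub_pow` need checking: the finite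
products are bounded uniformly in `k` and `n`, so geometric series dominate. -/
theorem tsum_pentagonal {q : ℂ} (hq : ‖q‖ < 1)
    (hs : Summable fun k : ℕ => (-1) ^ k * (q ^ pentagonal (-k) - q ^ pentagonal (k + 1))) :
    ∏' n : ℕ, (1 - q ^ (n + 1)) =
      ∑' k : ℕ, (-1) ^ k * (q ^ pentagonal (-k) - q ^ pentagonal (k + 1)) := by
  have hg := summable_geometric_of_lt_one (norm_nonneg _) hq
  have hb : ∀ k n : ℕ, ‖q ^ ((k + 1) * n) * ∏ i ∈ Finset.range (n + 1), (1 - q ^ (k + i + 1))‖ ≤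
      ‖q‖ ^ n * Real.exp (1 - ‖q‖)⁻¹ := fun k n => by
    rw [norm_mul, norm_pow]
    refine mul_le_mul ?_ (norm_prod_one_sub_pow_le hq k n) (norm_nonneg _) (by positivity)
    exact pow_le_pow_of_le_one (norm_nonneg _) hq.le (by nlinarith)
  refine Pentagonal.tprod_one_sub_pow (tendsto_pow_atTop_nhds_zero_of_norm_lt_one hq)
    (fun k => (hg.mul_right _).of_norm_bounded (hb k)) (fun k => ?_) hs ?_
  · simp only [sub_eq_add_neg]
    refine multipliable_one_add_of_summable ?_
    simp only [norm_neg, norm_pow, add_assoc]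
    exact (summable_nat_add_iff (k + 1)).mpr hg
  · refine squeeze_zero_norm (fun k => ?_) (a := fun k =>
      ‖q‖ ^ k * ∑' n, ‖q‖ ^ n * Real.exp (1 - ‖q‖)⁻¹) ?_
    · rw [norm_mul, norm_mul, norm_pow, norm_neg, norm_one, one_pow, one_mul, norm_pow]
      refine mul_le_mul ?_ (tsum_of_norm_bounded (hg.mul_right _).hasSum (hb k)) (norm_nonneg _)
        (by positivity)
      refine pow_le_pow_of_le_one (norm_nonneg _) hq.le ?_
      rw [Nat.le_div_iff_mul_le (by norm_num)]
      nlinarith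
    · simpa using (tendsto_pow_atTop_nhds_zero_of_lt_one (norm_nonneg _) hq).mul_const
        (∑' n, ‖q‖ ^ n * Real.exp (1 - ‖q‖)⁻¹)

/-- `∑_j (-1)^j q^{j(3j-1)/2} = ½ q^{-1/24} ∑_n χ(n) q^{n²/24}`. -/
theorem hasSum_pentagonal (τ : ℍ) :
    HasSum (fun j : ℤ => ((j.negOnePow : ℤ) : ℂ) * ee τ ^ pentagonal j)
      ((2 * ee (τ / 24))⁻¹ * thetaSeries 12 chiC τ 0) := by
  -- The two branches ±(6j - 1) run once through the integers with χ(n) ≠ 0. They contribute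
  -- equally, whence the factor 2.
  set e : ℤ ⊕ ℤ → ℤ := Sum.elim (fun j => 6 * j - 1) (fun j => -(6 * j - 1)) with he
  have hinj : e.Injective := by
    rintro (a | a) (b | b) h <;> simp only [he, Sum.elim_inl, Sum.elim_inr] at h <;>
      first | omega | (congr 1; omega)
  set g : ℤ → ℂ := fun j => ((j.negOnePow : ℤ) : ℂ) * ee τ ^ pentagonal j with hg
  have hfe := (hinj.hasSum_iff fun n hn => ?_).mpr (hasSum_thetaSeries chiC τ 0)
  · have hpent : ∀ j : ℤ, ee ((6 * j - 1) ^ 2 / 24 * τ) = ee (τ / 24) * ee τ ^ pentagonal j := by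
      intro j
      rw [← ee_nat_mul, ← ee_add]
      have h2 : 2 * (pentagonal j : ℂ) = j * (3 * j - 1) := by
        exact_mod_cast two_mul_natCast_pentagonal j
      congr 1
      linear_combination (-(τ : ℂ) / 2) * h2
    have hl : ∀ j : ℤ, chiC ((6 * j - 1 : ℤ) : ZMod 12) = (j.negOnePow : ℤ) := fun j => by
      have := chi_six_mul_sub_one j
      rw [chiC, this]; norm_cast
    have hterm : (fun n : ℤ => chiC n * ee ((n : ℂ) ^ 2 / (2 * (12 : ℕ)) * τ + n * 0)) ∘ e =
        Sum.elim (fun j => ee (τ / 24) * g j) (fun j => ee (τ / 24) * g j) := by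
      funext x
      have h24 : (2 * ((12 : ℕ) : ℂ)) = 24 := by norm_num
      rcases x with j | j
      · simp only [Function.comp_apply, he, Sum.elim_inl, hl, hg, mul_zero, add_zero, h24]
        have := hpent j
        push_cast
        rw [this]; ring
      · simp only [Function.comp_apply, he, Sum.elim_inr, hg, mul_zero, add_zero, h24]
        have := hpent j
        rw [Int.cast_neg, chiC, chi_neg, ← chiC, hl]
        push_cast
        rw [neg_sq, this]; ring
    rw [hterm] at hfe
    have hsg : Summable g := by
      have := hfe.summable.comp_injective Sum.inl_injective
      rw [Sum.elim_comp_inl] at this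
      exact (summable_mul_left_iff (ee_ne_zero _)).mp this
    have h1 := hsg.hasSum.mul_left (ee (τ / 24))
    have h2 := HasSum.sum (f := Sum.elim (fun j => ee (τ / 24) * g j) (fun j => ee (τ / 24) * g j))
      (by rwa [Sum.elim_comp_inl]) (by rwa [Sum.elim_comp_inr])
    rw [hfe.unique h2]
    convert hsg.hasSum using 1
    field_simp [ee_ne_zero]
    ring
  · have : chi n = 0 := by
      by_contra hne
      obtain ⟨j, hj | hj⟩ := exists_eq_of_chi_ne_zero hne
      · exact hn ⟨Sum.inl j, hj.symm⟩
      · exact hn ⟨Sum.inr j, hj.symm⟩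
    rw [chiC, this]; simp

/-- A zero would make the pentagonal series vanish, hence also Euler's product ∏ (1 - qⁿ), which has
no zeros for |q| < 1. -/
theorem thetaSeries_chiC_ne_zero (τ : ℍ) : thetaSeries 12 chiC τ 0 ≠ 0 := by
  intro h0
  have h := hasSum_pentagonal τ
  rw [h0, mul_zero] at h
  -- After j ↦ -j, pairing k with -(k + 1) gives exactly the grouping used in `tsum_pentagonal`.
  have h1 : HasSum (fun j : ℤ => (((-j).negOnePow : ℤ) : ℂ) * ee τ ^ pentagonal (-j)) 0 :=
    (Equiv.neg ℤ).hasSum_iff.mpr h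
  have h2 := h1.nat_add_neg_add_one
  have h3 : HasSum (fun k : ℕ => (-1) ^ k * (ee τ ^ pentagonal (-k) - ee τ ^ pentagonal (k + 1)))
      0 := by
    refine h2.congr_fun fun k => ?_
    rw [neg_neg, Int.negOnePow_succ, Int.negOnePow_neg, Int.negOnePow_def, zpow_natCast]
    push_cast
    ring
  have h4 := tsum_pentagonal (norm_ee_lt_one τ) h3.summable
  rw [h3.tsum_eq] at h4
  refine ModularForm.eta_tprod_ne_zero (z := τ) τ.2 ?_
  rw [← h4]
  congr 1; funext n
  rw [ModularForm.eta_q_eq_pow]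
  rfl

theorem hasQExp_thetaSeries_chiC_inv :
    HasQExp (-(1 / 24)) fun τ => (thetaSeries 12 chiC τ 0)⁻¹ := by
  refine HasQExp.inv (α := 1 / 24)
    (c := fun n => 2 * PowerSeries.coeff n (PowerSeries.pentagonalSeries ℚ)) (fun τ => ?_) ?_
    thetaSeries_chiC_ne_zero
  · have h := (hasSum_pentagonal τ).mul_left (2 * ee (τ / 24))
    rw [mul_inv_cancel_left₀ (mul_ne_zero two_ne_zero (ee_ne_zero _))] at h
    refine (pentagonal_injective.hasSum_iff fun n hn => ?_).mp (h.congr_fun fun j => ?_)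
    · rw [PowerSeries.coeff_pentagonalSeries_eq_zero _ hn]; simp
    · simp only [Function.comp_apply, PowerSeries.coeff_pentagonalSeries_pentagonal]
      rw [ee_add_nat_mul]
      push_cast
      rw [show (1 / 24 * (τ : ℂ)) = τ / 24 by ring]
      ring
  · have := PowerSeries.coeff_pentagonalSeries_pentagonal ℚ 0
    rw [show pentagonal 0 = 0 by decide] at this
    simp [this]

section

/-! ### Theta decomposition of `∏ ϑ(τ, aᵢ z)` -/

theorem hasSum_mul_of_summable_norm {ι κ : Type*} {f : ι → ℂ} {g : κ → ℂ} {y : ℂ}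
    (hf : Summable fun i => ‖f i‖) (hg : Summable fun i => ‖g i‖) (hy : HasSum g y) :
    HasSum (fun p : ι × κ => f p.1 * g p.2) ((∑' i, f i) * y) :=
  hf.of_norm.hasSum.mul hy (summable_mul_of_summable_norm hf hg)

theorem hasSum_pi_prod {k : ℕ} (f : Fin k → ℤ → ℂ) (hf : ∀ i, Summable fun n => ‖f i n‖) :
    (Summable fun n : Fin k → ℤ => ‖∏ i, f i (n i)‖) ∧
      HasSum (fun n : Fin k → ℤ => ∏ i, f i (n i)) (∏ i, ∑' n, f i n) := by
  induction k with
  | zero =>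
    refine ⟨(hasSum_fintype _).summable, ?_⟩
    convert hasSum_fintype (fun n : Fin 0 → ℤ => ∏ i, f i (n i)) using 1
    simp
  | succ k ih =>
    obtain ⟨h1, h2⟩ := ih (fun i => f i.succ) fun i => hf i.succ
    have hs := hasSum_mul_of_summable_norm (f := f 0)
      (g := fun n : Fin k → ℤ => ∏ i : Fin k, f i.succ (n i)) (hf 0) h1 h2
    have hn' := Summable.mul_norm (f := f 0)
      (g := fun n : Fin k → ℤ => ∏ i : Fin k, f i.succ (n i)) (hf 0) h1
    let e : ℤ × (Fin k → ℤ) ≃ (Fin (k + 1) → ℤ) := Fin.consEquiv fun _ => ℤ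
    have he : ∀ p, ∏ i, f i (e p i) = f 0 p.1 * ∏ i : Fin k, f i.succ (p.2 i) := fun p => by
      rw [Fin.prod_univ_succ]; rfl
    refine ⟨e.summable_iff.mp (hn'.congr fun p => ?_), e.hasSum_iff.mp ?_⟩
    · rw [Function.comp_apply, he]
    · rw [Fin.prod_univ_succ]
      exact hs.congr_fun fun p => he p

/-- `χ(n₁)⋯χ(n₅)`. -/
def chiProd (n : Fin 5 → ℤ) : ℚ := ∏ i, chi (n i)

theorem exists_sum_sq_eq {n : Fin 5 → ℤ} (h : chiProd n ≠ 0) :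
    ∃ k : ℤ, ∑ i, n i ^ 2 = 5 + 24 * k := by
  choose k hk using fun i => exists_sq_eq_of_chi_ne_zero (Finset.prod_ne_zero_iff.mp h i (by simp))
  refine ⟨∑ i, k i, ?_⟩
  simp [hk, Finset.sum_add_distrib, Finset.mul_sum]

variable (a : Fin 5 → ℤ) (Q : ℕ)

/-- The exponent `(n,n)/24 - (a,n)²/24Q`. -/
def perpExponent (n : Fin 5 → ℤ) : ℚ :=
  (∑ i, (n i : ℚ) ^ 2) / 24 - (∑ i, (a i : ℚ) * n i) ^ 2 / (24 * Q)

/-- The theta function of the coset `{n | (a,n) = r}`, projected to the orthogonal complement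
of `a`. -/
def perpTheta (r : ℤ) (τ : ℍ) : ℂ :=
  ∑' n : {n : Fin 5 → ℤ // ∑ i, a i * n i = r}, (chiProd n : ℂ) * ee (perpExponent a Q n * τ)

/-- The norm of n is split into its part along `a`, which is (a,n)²/Q when ∑ a_i² = Q, and the rest.
The second exponential depends on n only through (a,n). -/
theorem hasSum_prod_thetaSeries (τ : ℍ) (z : ℂ) :
    HasSum (fun n : Fin 5 → ℤ => (chiProd n : ℂ) * ee (perpExponent a Q n * τ) *
        ee (((∑ i, a i * n i : ℤ) : ℂ) ^ 2 / (24 * Q) * τ + (∑ i, a i * n i : ℤ) * z))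
      (∏ i, thetaSeries 12 chiC τ (a i * z)) := by
  have h := (hasSum_pi_prod (fun i (n : ℤ) => chiC n * ee ((n : ℂ) ^ 2 / (2 * (12 : ℕ)) * τ +
    n * (a i * z))) fun i => summable_norm_thetaSeries chiC τ _).2
  refine h.congr_fun fun n => ?_
  rw [Finset.prod_mul_distrib, mul_assoc, ← ee_add, chiProd]
  rw [← ee_sum]
  congr 1
  · push_cast; rfl
  · congr 1
    rw [Finset.sum_add_distrib, perpExponent]
    have hz : ∑ i, (n i : ℂ) * (a i * z) = (∑ i, (a i : ℂ) * n i) * z := by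
      rw [Finset.sum_mul]; exact Finset.sum_congr rfl fun i _ => by ring
    rw [hz]
    push_cast
    rw [← Finset.sum_mul, ← Finset.sum_div]
    ring

/-- Summability is inherited from a fibre of the five-fold product, on which the factor depending on
(a,n) is a nonzero constant. -/
theorem hasSum_perpTheta (r : ℤ) (τ : ℍ) :
    HasSum (fun n : {n : Fin 5 → ℤ // ∑ i, a i * n i = r} =>
      (chiProd n : ℂ) * ee (perpExponent a Q n * τ)) (perpTheta a Q r τ) := by
  have h := ((Equiv.sigmaFiberEquiv fun n : Fin 5 → ℤ => ∑ i, a i * n i).hasSum_iff.mpr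
    (hasSum_prod_thetaSeries a Q τ 0)).summable.sigma_factor r
  refine Summable.hasSum ((summable_mul_right_iff
    (ee_ne_zero ((r : ℂ) ^ 2 / (24 * Q) * τ + r * 0))).mp (h.congr fun n => ?_))
  simp only [Function.comp_apply, Equiv.sigmaFiberEquiv_apply]
  rw [n.2]

/-- The theta decomposition: terms of the product are collected according to r = (a,n). -/
theorem hasSum_perpTheta_mul (τ : ℍ) (z : ℂ) :
    HasSum (fun r : ℤ => perpTheta a Q r τ * ee ((r : ℂ) ^ 2 / (24 * Q) * τ + r * z))
      (∏ i, thetaSeries 12 chiC τ (a i * z)) := by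
  have h := (Equiv.sigmaFiberEquiv fun n : Fin 5 → ℤ => ∑ i, a i * n i).hasSum_iff.mpr
    (hasSum_prod_thetaSeries a Q τ z)
  refine h.sigma fun r => ((hasSum_perpTheta a Q r τ).mul_right _).congr_fun fun n => ?_
  simp only [Function.comp_apply, Equiv.sigmaFiberEquiv_apply]
  rw [n.2]

variable {a Q}

theorem perpTheta_neg (r : ℤ) (τ : ℍ) : perpTheta a Q (-r) τ = perpTheta a Q r τ := by
  let e : {n : Fin 5 → ℤ // ∑ i, a i * n i = r} ≃ {n : Fin 5 → ℤ // ∑ i, a i * n i = -r} :=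
    (Equiv.neg _).subtypeEquiv fun n => by simp [Finset.sum_neg_distrib]
  rw [perpTheta, ← e.tsum_eq, perpTheta]
  refine tsum_congr fun n => ?_
  have h1 : chiProd (e n) = chiProd n := by
    refine Finset.prod_congr rfl fun i _ => ?_
    rw [show (e n : Fin 5 → ℤ) i = -(n : Fin 5 → ℤ) i from rfl, Int.cast_neg, chi_neg]
  have h2 : perpExponent a Q (e n) = perpExponent a Q n := by
    have : ∀ i, (e n : Fin 5 → ℤ) i = -(n : Fin 5 → ℤ) i := fun _ => rfl
    simp [perpExponent, this, Finset.sum_neg_distrib]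
  rw [h1, h2]

/-- Translating n by 12j a raises (a,n) by 12Qj, preserves n modulo 12 and does not change the
projection orthogonal to `a`. -/
theorem perpTheta_add (hQ : ∑ i, a i ^ 2 = Q) (hQ0 : 0 < Q) (r j : ℤ) (τ : ℍ) :
    perpTheta a Q (r + 12 * Q * j) τ = perpTheta a Q r τ := by
  let e : {n : Fin 5 → ℤ // ∑ i, a i * n i = r} ≃
      {n : Fin 5 → ℤ // ∑ i, a i * n i = r + 12 * Q * j} :=
    (Equiv.addRight ((12 * j) • a)).subtypeEquiv fun n => by
      have : ∑ i, a i * (n + (12 * j) • a) i = ∑ i, a i * n i + 12 * Q * j := by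
        rw [← hQ, Finset.mul_sum, Finset.sum_mul, ← Finset.sum_add_distrib]
        refine Finset.sum_congr rfl fun i _ => ?_
        simp only [Pi.add_apply, Pi.smul_apply, smul_eq_mul]; ring
      rw [Equiv.coe_addRight, this, add_left_inj]
  have he : ∀ n i, (e n : Fin 5 → ℤ) i = (n : Fin 5 → ℤ) i + 12 * j * a i := fun _ _ => rfl
  rw [perpTheta, ← e.tsum_eq, perpTheta]
  refine tsum_congr fun n => ?_
  have h1 : chiProd (e n) = chiProd n := by
    refine Finset.prod_congr rfl fun i _ => ?_
    have h12 : (12 : ZMod 12) = 0 := rfl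
    rw [he]
    push_cast
    rw [h12]; simp
  have h2 : perpExponent a Q (e n) = perpExponent a Q n := by
    have hQQ : ∑ i, (a i : ℚ) ^ 2 = Q := by exact_mod_cast hQ
    have hQne : (Q : ℚ) ≠ 0 := by exact_mod_cast hQ0.ne'
    have e1 : ∑ i, ((e n : Fin 5 → ℤ) i : ℚ) ^ 2 = ∑ i, ((n : Fin 5 → ℤ) i : ℚ) ^ 2 +
        24 * j * (∑ i, (a i : ℚ) * (n : Fin 5 → ℤ) i) + 144 * j ^ 2 * Q := by
      rw [← hQQ, Finset.mul_sum, Finset.mul_sum, ← Finset.sum_add_distrib,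
        ← Finset.sum_add_distrib]
      refine Finset.sum_congr rfl fun i _ => ?_
      rw [he]; push_cast; ring
    have e2 : ∑ i, (a i : ℚ) * (e n : Fin 5 → ℤ) i =
        ∑ i, (a i : ℚ) * (n : Fin 5 → ℤ) i + 12 * j * Q := by
      rw [← hQQ, Finset.mul_sum, ← Finset.sum_add_distrib]
      refine Finset.sum_congr rfl fun i _ => ?_
      rw [he]; push_cast; ring
    rw [perpExponent, perpExponent, e1, e2]
    field_simp
    ring
  rw [h1, h2]

/-- Each n_i² is 1 modulo 24 where χ(n_i) ≠ 0, so (n,n)/24 is 5/24 modulo 1. -/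
theorem perpTheta_T_smul (r : ℤ) (τ : ℍ) :
    perpTheta a Q r (ModularGroup.T • τ) =
      ee (5 / 24 - (r : ℂ) ^ 2 / (24 * Q)) * perpTheta a Q r τ := by
  refine (((hasSum_perpTheta a Q r τ).mul_left _).congr_fun fun n => ?_).tsum_eq
  rcases eq_or_ne (chiProd n) 0 with h0 | h0
  · rw [h0]; simp
  obtain ⟨k, hk⟩ := exists_sum_sq_eq h0
  have hk' : (∑ i, ((n : Fin 5 → ℤ) i : ℂ) ^ 2) = 5 + 24 * k := by exact_mod_cast hk
  have hr : (∑ i, (a i : ℂ) * ((n : Fin 5 → ℤ) i : ℂ)) = r := by exact_mod_cast n.2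
  rw [UpperHalfPlane.modular_T_smul, UpperHalfPlane.coe_vadd, mul_add, ee_add]
  have : ee ((perpExponent a Q n : ℂ) * (1 : ℝ)) = ee (5 / 24 - (r : ℂ) ^ 2 / (24 * Q)) := by
    rw [ee_eq_iff]
    refine ⟨k, ?_⟩
    rw [perpExponent]
    push_cast
    rw [hk', hr]; ring
  rw [this]; ring

theorem perpExponent_nonneg (hQ : ∑ i, a i ^ 2 = Q) (hQ0 : 0 < Q) (n : Fin 5 → ℤ) :
    0 ≤ perpExponent a Q n := by
  have h := Finset.sum_mul_sq_le_sq_mul_sq Finset.univ (fun i => (a i : ℚ)) (fun i => (n i : ℚ))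
  have hQQ : ∑ i, (a i : ℚ) ^ 2 = Q := by exact_mod_cast hQ
  have hQpos : (0 : ℚ) < Q := by exact_mod_cast hQ0
  rw [hQQ] at h
  rw [perpExponent, sub_nonneg, div_le_div_iff₀ (by positivity) (by norm_num)]
  linarith

/-- All exponents that occur lie in one class modulo 1. The hypothesis bounds them below, and for
fixed r a bounded exponent leaves only finitely many integer points n. -/
theorem hasQExp_perpTheta (r B : ℤ) (h : ∀ n : Fin 5 → ℤ, ∑ i, a i * n i = r → chiProd n ≠ 0 →
      5 / 24 - (r : ℚ) ^ 2 / (24 * Q) + B ≤ perpExponent a Q n) :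
    HasQExp (5 / 24 - (r : ℚ) ^ 2 / (24 * Q) + B) (perpTheta a Q r) := by
  let s : Set {n : Fin 5 → ℤ // ∑ i, a i * n i = r} := {n | chiProd n ≠ 0}
  have hpe : ∀ n : {n : Fin 5 → ℤ // ∑ i, a i * n i = r}, perpExponent a Q n =
      (∑ i, (((n : Fin 5 → ℤ) i : ℤ) : ℚ) ^ 2) / 24 - (r : ℚ) ^ 2 / (24 * Q) := fun n => by
    have hr : (∑ i, (a i : ℚ) * ((n : Fin 5 → ℤ) i : ℚ)) = r := by exact_mod_cast n.2
    rw [perpExponent, hr]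
  refine HasQExp.of_hasSum (ι := s) (x := fun n => perpExponent a Q n.1)
    (w := fun n => chiProd n.1) (fun n => ?_) (fun k => ?_) fun τ => ?_
  · obtain ⟨k, hk⟩ := exists_sum_sq_eq n.2
    have hk' : (∑ i, ((n.1.1 i : ℤ) : ℚ) ^ 2) = 5 + 24 * k := by exact_mod_cast hk
    have h1 := h n.1.1 n.1.2 n.2
    rw [hpe, hk'] at h1 ⊢
    have hB : B ≤ k := by
      have : (B : ℚ) ≤ k := by linarith
      exact_mod_cast this
    obtain ⟨m, hm⟩ := Int.eq_ofNat_of_zero_le (sub_nonneg.mpr hB)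
    refine ⟨m, ?_⟩
    have : (k : ℚ) - B = m := by exact_mod_cast hm
    linear_combination this
  · obtain ⟨C, hC⟩ := exists_nat_ge (24 * (5 / 24 - (r : ℚ) ^ 2 / (24 * Q) + B + k +
      (r : ℚ) ^ 2 / (24 * Q)))
    have hfin : {n : Fin 5 → ℤ | ∑ i, n i ^ 2 ≤ C}.Finite := by
      refine (Set.finite_Icc (fun _ => -(C : ℤ)) (fun _ => (C : ℤ))).subset fun n hn => ?_
      have hi : ∀ i, n i ^ 2 ≤ C := fun i =>
        (Finset.single_le_sum (f := fun i => n i ^ 2) (fun j _ => sq_nonneg _)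
          (Finset.mem_univ i)).trans hn
      exact ⟨fun i => by have := hi i; show -(C : ℤ) ≤ n i; nlinarith,
        fun i => by have := hi i; show n i ≤ C; nlinarith⟩
    refine Set.Finite.of_injOn (f := fun n : s => n.1.1) (t := {n : Fin 5 → ℤ | ∑ i, n i ^ 2 ≤ C})
      (fun n hn => ?_) (fun x _ y _ hxy => Subtype.ext (Subtype.ext hxy)) hfin
    have hn' : perpExponent a Q n.1 = _ := hn
    rw [hpe] at hn'
    have : (∑ i, ((n.1.1 i : ℤ) : ℚ) ^ 2) ≤ C := by linarith
    exact_mod_cast this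
  · refine (hasSum_subtype_iff_of_support_subset fun n hn => ?_).mpr (hasSum_perpTheta a Q r τ)
    intro h0
    exact hn (by simp [h0])

theorem hasQExp_perpTheta' (hQ : ∑ i, a i ^ 2 = Q) (hQ0 : 0 < Q) (r : ℤ) :
    ∃ α, HasQExp α (perpTheta a Q r) := by
  -- The shift -1 makes the starting exponent negative, which suffices since all exponents are
  -- nonnegative.
  refine ⟨_, hasQExp_perpTheta r (-1) fun n _ _ => le_trans ?_ (perpExponent_nonneg hQ hQ0 n)⟩
  have : 0 ≤ (r : ℚ) ^ 2 / (24 * Q) := by positivity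
  push_cast
  linarith

end

/-! ### A vector valued modular form of weight `-1/2` -/

section WeilVector

variable {a : Fin 5 → ℤ} {Q : ℕ}

variable (a Q) in
/-- The theta coefficients of `∏ ϑ(τ, aᵢ z) / ϑ(τ, 0)`. -/
def weilVector (r : ZMod (12 * Q)) (τ : ℍ) : ℂ :=
  perpTheta a Q r.val τ * ((thetaSeries 12 chiC τ 0)⁻¹) ^ 5

/-- For r = 0 the exponent is (n,n)/24, at least B + 5/24; the five factors 1/ϑ(τ,0) remove 5/24. -/
theorem hasQExp_weilVector_zero {B : ℕ} (h : ∀ n : Fin 5 → ℤ, ∑ i, a i * n i = 0 →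
    chiProd n ≠ 0 → 24 * B + 5 ≤ ∑ i, n i ^ 2) : HasQExp B (weilVector a Q 0) := by
  have h1 := hasQExp_perpTheta (a := a) (Q := Q) 0 B fun n hn hc => by
    have h2 : (24 * B + 5 : ℚ) ≤ ∑ i, (n i : ℚ) ^ 2 := by exact_mod_cast h n hn hc
    have h3 : ∑ i, (a i : ℚ) * n i = 0 := by exact_mod_cast hn
    rw [perpExponent, h3]
    push_cast
    simp only [ne_eq, OfNat.ofNat_ne_zero, not_false_eq_true, zero_pow, zero_div, sub_zero]
    linarith
  have h4 := h1.mul (hasQExp_thetaSeries_chiC_inv.pow 5)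
  have : (5 / 24 - ((0 : ℤ) : ℚ) ^ 2 / (24 * Q) + (B : ℤ) + (5 : ℕ) * (-(1 / 24)) : ℚ) = B := by
    push_cast; ring
  rw [this] at h4
  convert h4 using 2 with τ
  rw [weilVector, ZMod.val_zero]
  rfl

variable [NeZero Q]

theorem perpTheta_val (hQ : ∑ i, a i ^ 2 = Q) (r : ℤ) (τ : ℍ) :
    perpTheta a Q (r : ZMod (12 * Q)).val τ = perpTheta a Q r τ := by
  obtain ⟨j, hj⟩ := (ZMod.intCast_eq_intCast_iff_dvd_sub ((r : ZMod (12 * Q)).val : ℤ) r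
    (12 * Q)).mp (by simp)
  have : r = (r : ZMod (12 * Q)).val + 12 * Q * j := by push_cast at hj; linarith
  conv_rhs => rw [this, perpTheta_add hQ (NeZero.pos Q)]

theorem thetaSeries_perpTheta (hQ : ∑ i, a i ^ 2 = Q) (τ : ℍ) (z : ℂ) :
    thetaSeries (12 * Q) (fun r => perpTheta a Q r.val τ) τ z =
      ∏ i, thetaSeries 12 chiC τ (a i * z) := by
  refine ((hasSum_perpTheta_mul a Q τ z).congr_fun fun r => ?_).tsum_eq
  beta_reduce
  rw [perpTheta_val hQ]
  congr 4
  push_cast; ring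

theorem S_smul_S_smul (τ : ℍ) : ModularGroup.S • ModularGroup.S • τ = τ := by
  ext
  rw [coe_S_smul, coe_S_smul]
  have := τ.ne_zero
  field_simp

/-- The product of the five theta functions is transformed in two ways, factor by factor and through
its theta decomposition. As z varies the theta coefficients are determined, so they can be compared.
One of the five square roots is absorbed by the unary theta series, leaving weight 2. -/
theorem perpTheta_S_smul (hQ : ∑ i, a i ^ 2 = Q) (τ : ℍ) (r : ZMod (12 * Q)) :
    perpTheta a Q r.val (ModularGroup.S • τ) =
      sqrtNegI τ ^ 4 / (Real.sqrt (12 * Q : ℕ) : ℝ) *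
        ∑ s : ZMod (12 * Q), ZMod.stdAddChar (s * r) * perpTheta a Q s.val τ := by
  -- The comparison is made at τ' = -1/τ, which S sends back to τ.
  set τ' : ℍ := ModularGroup.S • τ with hτ'
  have hss : ModularGroup.S • τ' = τ := S_smul_S_smul τ
  have hne := τ'.ne_zero
  have hs := sqrtNegI_ne_zero τ'
  have hQC : (Q : ℂ) = ∑ i, (a i : ℂ) ^ 2 := by exact_mod_cast hQ.symm
  have key : (fun r : ZMod (12 * Q) => sqrtNegI τ' ^ 5 * perpTheta a Q r.val τ') =
      fun r => sqrtNegI τ' / (Real.sqrt (12 * Q : ℕ) : ℝ) *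
        𝓕 (fun s : ZMod (12 * Q) => perpTheta a Q s.val τ) r := by
    refine thetaSeries_injective (τ := τ') fun z => ?_
    rw [thetaSeries_smul, thetaSeries_smul, thetaSeries_perpTheta hQ]
    have h1 := thetaSeries_S_smul (fun s : ZMod (12 * Q) => perpTheta a Q s.val τ) τ' z
    rw [hss, thetaSeries_perpTheta hQ] at h1
    have h2 : ∏ i, thetaSeries 12 chiC τ (a i * (z / τ')) =
        sqrtNegI τ' ^ 5 * ee (((12 * Q : ℕ) : ℂ) * z ^ 2 / (2 * τ')) *
          ∏ i, thetaSeries 12 chiC τ' (a i * z) := by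
      have h3 : ∀ i, thetaSeries 12 chiC τ (a i * (z / τ')) =
          sqrtNegI τ' * ee (6 * (a i * z) ^ 2 / τ') * thetaSeries 12 chiC τ' (a i * z) := fun i => by
        rw [← thetaSeries_chiC_S_smul, hss, mul_div_assoc]
      rw [Finset.prod_congr rfl fun i _ => h3 i, Finset.prod_mul_distrib, Finset.prod_mul_distrib,
        ← ee_sum, Finset.prod_const, Finset.card_univ, Fintype.card_fin]
      congr 3
      push_cast
      rw [hQC, Finset.mul_sum, Finset.sum_mul, Finset.sum_div]
      refine Finset.sum_congr rfl fun i _ => ?_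
      field_simp; ring
    rw [h2] at h1
    refine mul_left_cancel₀ (ee_ne_zero (((12 * Q : ℕ) : ℂ) * z ^ 2 / (2 * τ'))) ?_
    linear_combination h1
  have hr := congrFun key r
  have hinv : sqrtNegI τ' = (sqrtNegI τ)⁻¹ := sqrtNegI_S_smul τ
  have hsum : 𝓕 (fun s : ZMod (12 * Q) => perpTheta a Q s.val τ) r =
      ∑ s : ZMod (12 * Q), ZMod.stdAddChar (s * r) * perpTheta a Q s.val τ := by
    rw [ZMod.dft_apply, ← Equiv.sum_comp (Equiv.neg (ZMod (12 * Q)))]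
    refine Finset.sum_congr rfl fun s _ => ?_
    -- Since χ is even, the coefficients are even in s; this reverses the sign in the Fourier
    -- kernel.
    have : perpTheta a Q ((-s).val : ℤ) τ = perpTheta a Q (s.val : ℤ) τ := by
      have h := perpTheta_val hQ (-(s.val : ℤ)) τ
      rwa [perpTheta_neg, show (((-(s.val : ℤ) : ℤ)) : ZMod (12 * Q)) = -s by simp] at h
    rw [Equiv.neg_apply, neg_mul, neg_neg, this, smul_eq_mul]
  rw [← hsum]
  have h0 := sqrtNegI_ne_zero τ
  rw [hinv] at hr
  field_simp at hr
  rw [hr]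
  field_simp

/-- The arguments of -iτ and i add up to a number in (0, π), so the principal roots multiply without
a sign. -/
theorem sqrtNegI_inv (τ : ℍ) :
    (sqrtNegI τ)⁻¹ = ((τ : ℂ) ^ (1 / 2 : ℂ))⁻¹ * Complex.I ^ (1 / 2 : ℂ) := by
  have harg := abs_lt.mp (Complex.abs_arg_lt_pi_div_two_iff.mpr (Or.inl (re_neg_I_mul_pos τ)))
  have hpi := Real.pi_pos
  have hmul : sqrtNegI τ * Complex.I ^ (1 / 2 : ℂ) = (τ : ℂ) ^ (1 / 2 : ℂ) := by
    have hlog := Complex.log_mul (neg_I_mul_ne_zero τ) Complex.I_ne_zero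
      (by rw [Complex.arg_I]; constructor <;> linarith)
    have hI : -Complex.I * (τ : ℂ) * Complex.I = τ := by
      linear_combination (-(τ : ℂ)) * Complex.I_sq
    rw [hI] at hlog
    rw [sqrtNegI, Complex.cpow_def_of_ne_zero (neg_I_mul_ne_zero τ),
      Complex.cpow_def_of_ne_zero Complex.I_ne_zero, Complex.cpow_def_of_ne_zero τ.ne_zero, hlog,
      ← Complex.exp_add, add_mul]
  have hne : Complex.I ^ (1 / 2 : ℂ) ≠ 0 := by
    rw [Ne, Complex.cpow_eq_zero_iff]; exact fun h => Complex.I_ne_zero h.1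
  rw [← hmul]
  field_simp [sqrtNegI_ne_zero]

/-- Four factors √(-iτ) from the numerator against five from the denominator leave weight -1/2. -/
theorem weilVector_S_smul (hQ : ∑ i, a i ^ 2 = Q) (τ : ℍ) (r : ZMod (12 * Q)) :
    weilVector a Q r (ModularGroup.S • τ) = ((τ : ℂ) ^ (1 / 2 : ℂ))⁻¹ *
      (Complex.I ^ (1 / 2 : ℂ) * ((Real.sqrt (12 * Q : ℕ))⁻¹ : ℝ)) *
        ∑ s : ZMod (12 * Q), ZMod.stdAddChar (s * r) * weilVector a Q s τ := by
  have h := thetaSeries_chiC_S_smul τ 0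
  have hee : ee (6 * 0 ^ 2 / τ) = 1 := by simp [ee_zero]
  rw [zero_div, hee, mul_one] at h
  have h0 := sqrtNegI_ne_zero τ
  simp only [weilVector]
  rw [perpTheta_S_smul hQ, h, ← mul_assoc, ← sqrtNegI_inv]
  simp only [← mul_assoc]
  rw [← Finset.sum_mul]
  push_cast
  field_simp

theorem weilVector_T_smul (hQ : ∑ i, a i ^ 2 = Q) (τ : ℍ) (r : ℤ) :
    weilVector a Q r (ModularGroup.T • τ) =
      ee (-((r : ℂ) ^ 2 / (24 * Q))) * weilVector a Q r τ := by
  have hE : thetaSeries 12 chiC (ModularGroup.T • τ) 0 =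
      ee (1 / 24) * thetaSeries 12 chiC τ 0 := by
    refine (((hasSum_thetaSeries chiC τ 0).mul_left _).congr_fun fun n => ?_).tsum_eq
    rcases eq_or_ne (chi n) 0 with h0 | h0
    · rw [chiC, h0]; simp
    obtain ⟨k, hk⟩ := exists_sq_eq_of_chi_ne_zero h0
    have hk' : (n : ℂ) ^ 2 = 1 + 24 * k := by exact_mod_cast hk
    have : ee ((n : ℂ) ^ 2 / (2 * (12 : ℕ)) * (ModularGroup.T • τ : ℍ) + n * 0) =
        ee (1 / 24) * ee ((n : ℂ) ^ 2 / (2 * (12 : ℕ)) * τ + n * 0) := by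
      rw [← ee_add, ee_eq_iff]
      refine ⟨k, ?_⟩
      rw [UpperHalfPlane.modular_T_smul, UpperHalfPlane.coe_vadd]
      push_cast
      linear_combination hk' / 24
    rw [this]; ring
  have h5 : ee (5 / 24 - (r : ℂ) ^ 2 / (24 * Q)) =
      ee (-((r : ℂ) ^ 2 / (24 * Q))) * ee (1 / 24) ^ 5 := by
    rw [← ee_nat_mul, ← ee_add]; congr 1; push_cast; ring
  have := ee_ne_zero (1 / 24)
  have := thetaSeries_chiC_ne_zero τ
  rw [weilVector, weilVector, hE, perpTheta_val hQ, perpTheta_val hQ, perpTheta_T_smul, h5]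
  field_simp

/-- At z = 0 all five factors of the product equal ϑ(τ,0), so the quotient is 1. -/
theorem thetaSeries_weilVector (hQ : ∑ i, a i ^ 2 = Q) (τ : ℍ) :
    thetaSeries (12 * Q) (fun r => weilVector a Q r τ) τ 0 = 1 := by
  have h := thetaSeries_smul (((thetaSeries 12 chiC τ 0)⁻¹) ^ 5)
    (fun r : ZMod (12 * Q) => perpTheta a Q r.val τ) τ 0
  rw [thetaSeries_perpTheta hQ] at h
  simp only [weilVector, mul_comm (perpTheta _ _ _ _)]
  rw [h]
  have := thetaSeries_chiC_ne_zero τ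
  simp only [mul_zero, Finset.prod_const, Finset.card_univ, Fintype.card_fin]
  rw [← mul_pow, inv_mul_cancel₀ this, one_pow]

theorem hasQExp_weilVector (hQ : ∑ i, a i ^ 2 = Q) (r : ZMod (12 * Q)) :
    ∃ α, HasQExp α (weilVector a Q r) := by
  obtain ⟨α, hα⟩ := hasQExp_perpTheta' hQ (NeZero.pos Q) (r.val : ℤ)
  exact ⟨_, hα.mul (hasQExp_thetaSeries_chiC_inv.pow 5)⟩

end WeilVector

/-! ### Choice of the vector `a` -/

/-- Every positive square class contains a sum of five squares `Q = ∑ aᵢ²` such that no vector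
orthogonal to `a` with coordinates prime to 6 is short. -/
theorem exists_sum_five_squares (d B : ℕ) (hd : 0 < d) : ∃ (l : ℕ) (a : Fin 5 → ℤ), 0 < l ∧
    ∑ i, a i ^ 2 = (d * l ^ 2 : ℕ) ∧
    ∀ n : Fin 5 → ℤ, ∑ i, a i * n i = 0 → chiProd n ≠ 0 → 24 * B + 5 ≤ ∑ i, n i ^ 2 := by
  -- The argument below gives A ≤ 2D with D ≤ (n,n); since A ≥ l, this value of l yields the
  -- required bound. As A is the integer square root, the remainder split by Lagrange's theorem is
  -- at most 2A.
  set l := 2 * (24 * B + 5) with hl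
  set A := Nat.sqrt (d * l ^ 2) with hA
  have hlA : l ≤ A := Nat.le_sqrt.mpr (by nlinarith)
  have hA1 : A * A ≤ d * l ^ 2 := Nat.sqrt_le _
  have hA2 : d * l ^ 2 ≤ A * A + A + A := Nat.sqrt_le_add _
  obtain ⟨w, x, y, z, hw⟩ := Nat.sum_four_squares (d * l ^ 2 - A * A)
  have hsum : (A : ℤ) ^ 2 + (w ^ 2 + x ^ 2 + y ^ 2 + z ^ 2) = (d * l ^ 2 : ℕ) := by
    have : A ^ 2 + (w ^ 2 + x ^ 2 + y ^ 2 + z ^ 2) = d * l ^ 2 := by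
      rw [hw, sq]; omega
    exact_mod_cast this
  have hle : ((w : ℤ) ^ 2 + x ^ 2 + y ^ 2 + z ^ 2) ≤ 2 * A := by
    have : w ^ 2 + x ^ 2 + y ^ 2 + z ^ 2 ≤ 2 * A := by omega
    exact_mod_cast this
  refine ⟨l, ![A, w, x, y, z], by omega, ?_, fun n hn hc => ?_⟩
  · rw [← hsum]; simp [Fin.sum_univ_succ]; ring
  -- χ(0) = 0.
  · have h0 : n 0 ≠ 0 := fun h => Finset.prod_ne_zero_iff.mp hc 0 (by simp) (by rw [h]; rfl)
    have hn1 : (A : ℤ) * n 0 + (w * n 1 + x * n 2 + y * n 3 + z * n 4) = 0 := by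
      rw [← hn]; simp [Fin.sum_univ_succ]; ring
    have hns : ∑ i, n i ^ 2 = n 0 ^ 2 + (n 1 ^ 2 + n 2 ^ 2 + n 3 ^ 2 + n 4 ^ 2) := by
      simp [Fin.sum_univ_succ]; ring
    have hcs := Finset.sum_mul_sq_le_sq_mul_sq Finset.univ ![(w : ℤ), x, y, z]
      ![n 1, n 2, n 3, n 4]
    have e1 : ∑ i, ![(w : ℤ), x, y, z] i * ![n 1, n 2, n 3, n 4] i =
        w * n 1 + x * n 2 + y * n 3 + z * n 4 := by simp [Fin.sum_univ_succ]; ring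
    have e2 : ∑ i, ![(w : ℤ), x, y, z] i ^ 2 = w ^ 2 + x ^ 2 + y ^ 2 + z ^ 2 := by
      simp [Fin.sum_univ_succ]; ring
    have e3 : ∑ i, ![n 1, n 2, n 3, n 4] i ^ 2 = n 1 ^ 2 + n 2 ^ 2 + n 3 ^ 2 + n 4 ^ 2 := by
      simp [Fin.sum_univ_succ]; ring
    rw [e1, e2, e3] at hcs
    rw [hns]
    set D := n 1 ^ 2 + n 2 ^ 2 + n 3 ^ 2 + n 4 ^ 2 with hD
    have hD0 : 0 ≤ D := by positivity
    have h1 : 1 ≤ n 0 ^ 2 := by have : 0 < n 0 ^ 2 := by positivity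
                                omega
    have hApos : (0 : ℤ) < A := by omega
    -- Orthogonality makes A n_0 minus the inner product of the short remainder with the other four
    -- coordinates; Cauchy–Schwarz bounds it.
    have h2 : (A : ℤ) ^ 2 * n 0 ^ 2 ≤ 2 * A * D := by
      have h3 : (A : ℤ) ^ 2 * n 0 ^ 2 = (w * n 1 + x * n 2 + y * n 3 + z * n 4) ^ 2 := by
        have : (w * n 1 + x * n 2 + y * n 3 + z * n 4 : ℤ) = -(A * n 0) := by linarith
        rw [this]; ring
      rw [h3]
      exact hcs.trans (mul_le_mul_of_nonneg_right hle hD0)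
    have h4 : (A : ℤ) ≤ 2 * D := by
      have h5 : (A : ℤ) * A ≤ A * (2 * D) := by nlinarith
      exact le_of_mul_le_mul_left h5 hApos
    omega

/-! ### Adjoining a negative definite lattice of rank one -/

namespace EvenLattice

variable {V : Type u} [AddCommGroup V] [Module ℚ V] (N : EvenLattice V)

theorem finite_module (N : EvenLattice V) : Module.Finite ℚ V := by
  obtain ⟨s, hs⟩ := N.fg
  refine ⟨⟨s, ?_⟩⟩
  rw [← N.span_eq_top, ← hs]
  exact (Submodule.span_span_of_tower ℤ ℚ (s : Set V)).symm

theorem exists_nsmul_mem (x : V) : ∃ n : ℕ, n ≠ 0 ∧ n • x ∈ N.carrier := by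
  have hx : x ∈ Submodule.span ℚ (N.carrier : Set V) := by rw [N.span_eq_top]; trivial
  induction hx using Submodule.span_induction with
  | mem x h => exact ⟨1, one_ne_zero, by simpa using h⟩
  | zero => exact ⟨1, one_ne_zero, by simp⟩
  | add x y _ _ hx hy =>
    obtain ⟨n, hn, hx⟩ := hx
    obtain ⟨m, hm, hy⟩ := hy
    refine ⟨n * m, mul_ne_zero hn hm, ?_⟩
    rw [smul_add]
    refine add_mem ?_ ?_
    · rw [mul_comm, mul_smul]; exact nsmul_mem hx _
    · rw [mul_smul]; exact nsmul_mem hy _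
  | smul a x _ hx =>
    obtain ⟨n, hn, hx⟩ := hx
    refine ⟨n * a.den, mul_ne_zero hn a.den_ne_zero, ?_⟩
    have : (n * a.den) • a • x = a.num • n • x := by
      simp only [← Nat.cast_smul_eq_nsmul ℚ, ← Int.cast_smul_eq_zsmul ℚ, smul_smul]
      congr 1
      push_cast
      rw [mul_assoc, Rat.den_mul_eq_num, mul_comm]
    rw [this]
    exact N.carrier.smul_mem _ hx

theorem eq_zero_of_form_eq_zero {x : V} (h : ∀ y, N.form y x = 0) : x = 0 :=
  N.nondegenerate.2 x h

theorem finrank_eq : N.signature.1 + N.signature.2 = Module.finrank ℚ V := by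
  have := N.finite_module
  have h := QuadraticForm.sigPos_add_sigNeg_add_radical
    (Q := LinearMap.BilinMap.toQuadraticMap N.form)
  have hr : (LinearMap.BilinMap.toQuadraticMap N.form).radical = ⊥ := by
    rw [QuadraticMap.radical_eq_ker_polarBilin, Submodule.eq_bot_iff]
    intro x hx
    refine N.eq_zero_of_form_eq_zero fun y => ?_
    have h1 := LinearMap.congr_fun (LinearMap.mem_ker.mp hx) y
    have h2 := N.symm.eq x y
    simp [QuadraticMap.polar] at h1
    linarith
  rw [hr, finrank_bot, add_zero] at h
  exact h

/-- A nonzero vector of a maximal positive definite subspace has a multiple in the lattice. Its norm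
determines the square class of `K` for which the extended lattice is isotropic. -/
theorem exists_form_pos (h : 0 < N.signature.1) :
    ∃ x ∈ N.carrier, ∃ d : ℕ, 0 < d ∧ N.form x x = 2 * d := by
  have := N.finite_module
  obtain ⟨U, hU, hpos⟩ := exists_finrank_eq_sigPos_and_posDef
    (LinearMap.BilinMap.toQuadraticMap N.form)
  have : 0 < Module.finrank ℚ U := by rw [hU]; exact h
  have : Nontrivial U := Module.nontrivial_of_finrank_pos this
  obtain ⟨v, hv⟩ := exists_ne (0 : U)
  have hv1 : 0 < N.form v v := hpos v hv
  obtain ⟨n, hn, hnv⟩ := N.exists_nsmul_mem (v : V)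
  obtain ⟨m, hm⟩ := N.even _ hnv
  have hpos : 0 < N.form (n • (v : V)) (n • (v : V)) := by
    simp only [map_nsmul, LinearMap.smul_apply, nsmul_eq_mul]
    have : (0 : ℚ) < n := by exact_mod_cast Nat.pos_of_ne_zero hn
    positivity
  have hm0 : 0 < m := by
    rw [hm] at hpos
    have : (0 : ℚ) < m := by linarith
    exact_mod_cast this
  obtain ⟨d, rfl⟩ := Int.eq_ofNat_of_zero_le hm0.le
  exact ⟨_, hnv, d, by exact_mod_cast hm0, by rw [hm]; norm_cast⟩

variable (K : ℕ)

/-- The form `(x, y) - K s t` on `V ⊕ ℚ`. -/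
def formProd : LinearMap.BilinForm ℚ (V × ℚ) :=
  N.form.compl₁₂ (LinearMap.fst ℚ V ℚ) (LinearMap.fst ℚ V ℚ) -
    (K : ℚ) • (LinearMap.mul ℚ ℚ).compl₁₂ (LinearMap.snd ℚ V ℚ) (LinearMap.snd ℚ V ℚ)

@[simp]
theorem formProd_apply (x y : V × ℚ) :
    N.formProd K x y = N.form x.1 y.1 - K * (x.2 * y.2) := by
  simp [formProd]

variable [NeZero K]

/-- The orthogonal sum of `N` and `ℤ`, with the form `-K s t` on the second summand. -/
def addNegRankOne (hK : Even K) : EvenLattice (V × ℚ) where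
  form := N.formProd K
  symm := ⟨fun x y => by simp [N.symm.eq x.1 y.1, mul_comm]⟩
  nondegenerate := by
    have hK0 : (K : ℚ) ≠ 0 := by exact_mod_cast NeZero.ne K
    have key : ∀ x : V × ℚ, (∀ y, N.formProd K y x = 0) → x = 0 := by
      rintro ⟨x, t⟩ h
      have h1 : x = 0 := N.eq_zero_of_form_eq_zero fun y => by simpa using h (y, 0)
      have h2 : t = 0 := by simpa [hK0] using h (0, 1)
      rw [h1, h2]; rfl
    refine ⟨fun x h => key x fun y => ?_, key⟩
    rw [← h y, formProd_apply, formProd_apply, N.symm.eq, mul_comm x.2]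
  carrier := N.carrier.prod (Submodule.span ℤ {1})
  fg := N.fg.prod (Submodule.fg_span_singleton _)
  span_eq_top := by
    rw [eq_top_iff]
    rintro ⟨x, t⟩ -
    have h1 : (x, (0 : ℚ)) ∈ Submodule.span ℚ
        ((N.carrier.prod (Submodule.span ℤ {(1 : ℚ)}) : Submodule ℤ (V × ℚ)) : Set (V × ℚ)) := by
      have hx : x ∈ Submodule.span ℚ (N.carrier : Set V) := by rw [N.span_eq_top]; trivial
      have := Submodule.mem_map_of_mem (f := LinearMap.inl ℚ V ℚ) hx
      rw [Submodule.map_span] at this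
      refine Submodule.span_mono ?_ this
      rintro _ ⟨y, hy, rfl⟩
      exact ⟨hy, Submodule.zero_mem _⟩
    have h2 : ((0 : V), (1 : ℚ)) ∈ Submodule.span ℚ
        ((N.carrier.prod (Submodule.span ℤ {(1 : ℚ)}) : Submodule ℤ (V × ℚ)) : Set (V × ℚ)) :=
      Submodule.subset_span ⟨Submodule.zero_mem _, Submodule.mem_span_singleton_self _⟩
    have h3 : (x, t) = (x, (0 : ℚ)) + t • ((0 : V), (1 : ℚ)) := by simp
    rw [h3]
    exact add_mem h1 (Submodule.smul_mem _ _ h2)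
  even := by
    rintro ⟨x, t⟩ ⟨hx, ht⟩
    obtain ⟨k, rfl⟩ := Submodule.mem_span_singleton.mp ht
    obtain ⟨n, hn⟩ := N.even x hx
    obtain ⟨m, hm⟩ := hK
    refine ⟨n - m * k ^ 2, ?_⟩
    rw [formProd_apply, hn, hm]
    push_cast
    simp only [zsmul_eq_mul, mul_one]
    ring

variable (hK : Even K)

theorem mem_carrier_addNegRankOne {x : V × ℚ} :
    x ∈ (N.addNegRankOne K hK).carrier ↔ x.1 ∈ N.carrier ∧ ∃ n : ℤ, x.2 = n := by
  change x.1 ∈ N.carrier ∧ x.2 ∈ Submodule.span ℤ {(1 : ℚ)} ↔ _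
  rw [Submodule.mem_span_singleton]
  simp [eq_comm]

theorem form_addNegRankOne (x y : V × ℚ) :
    (N.addNegRankOne K hK).form x y = N.form x.1 y.1 - K * (x.2 * y.2) :=
  N.formProd_apply K x y

theorem mem_dual_addNegRankOne {x : V × ℚ} :
    x ∈ (N.addNegRankOne K hK).dual ↔ x.1 ∈ N.dual ∧ ∃ n : ℤ, K * x.2 = n := by
  simp only [mem_dual, mem_carrier_addNegRankOne, form_addNegRankOne]
  constructor
  · intro h
    refine ⟨fun y hy => ?_, ?_⟩
    · simpa using h (y, 0) ⟨hy, 0, by simp⟩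
    · obtain ⟨n, hn⟩ := h (0, 1) ⟨N.carrier.zero_mem, 1, by simp⟩
      refine ⟨-n, ?_⟩
      simp only [map_zero] at hn
      push_cast
      linarith
  · rintro ⟨h1, n, hn⟩ y ⟨hy, m, hm⟩
    obtain ⟨k, hk⟩ := h1 _ hy
    refine ⟨k - n * m, ?_⟩
    rw [hk, hm, ← mul_assoc, hn]
    push_cast; ring

/-- A positive definite subspace of dimension b and a negative line bound the two entries from
below; by nondegeneracy they add up to the dimension b + 1. -/
theorem signature_addNegRankOne {b : ℕ} (h : N.signature = (b, 0)) :
    (N.addNegRankOne K hK).signature = (b, 1) := by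
  have := N.finite_module
  have hK0 : (0 : ℚ) < K := by exact_mod_cast NeZero.pos K
  have h1 := N.finrank_eq
  have h2 := (N.addNegRankOne K hK).finrank_eq
  rw [Module.finrank_prod, Module.finrank_self, ← h1, h] at h2
  have h3 : b ≤ (N.addNegRankOne K hK).signature.1 := by
    obtain ⟨U, hU, hpos⟩ := exists_finrank_eq_sigPos_and_posDef
      (LinearMap.BilinMap.toQuadraticMap N.form)
    have hb : Module.finrank ℚ U = b := hU.trans (congrArg Prod.fst h)
    have hinj : Function.Injective (LinearMap.inl ℚ V ℚ) := LinearMap.inl_injective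
    rw [← hb, (Submodule.equivMapOfInjective _ hinj U).finrank_eq]
    refine le_sigPos_of_posDef _ ?_
    rintro ⟨_, y, hy, rfl⟩ hne
    have hy0 : (⟨y, hy⟩ : U) ≠ 0 := by
      rintro h0
      rw [Submodule.mk_eq_zero] at h0
      exact hne (by simp [h0])
    have := hpos _ hy0
    change 0 < (N.addNegRankOne K hK).form _ _
    rw [form_addNegRankOne]
    simpa using this
  have h4 : 1 ≤ (N.addNegRankOne K hK).signature.2 := by
    have hspan : Module.finrank ℚ (Submodule.span ℚ {((0 : V), (1 : ℚ))}) = 1 :=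
      finrank_span_singleton (by simp)
    rw [← hspan]
    refine le_sigNeg_of_negDef _ ?_
    rintro ⟨y, hy⟩ hne
    obtain ⟨t, rfl⟩ := Submodule.mem_span_singleton.mp hy
    have ht : t ≠ 0 := by
      rintro rfl
      exact hne (by simp)
    change 0 < -(N.addNegRankOne K hK).form _ _
    rw [form_addNegRankOne]
    simp only [Prod.smul_mk, smul_zero, smul_eq_mul, mul_one, map_zero, zero_sub, neg_neg]
    have : 0 < t * t := mul_self_pos.mpr ht
    positivity
  refine Prod.ext ?_ ?_ <;> dsimp only at h2 ⊢ <;> omega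

/-- The projection of the dual lattice to the discriminant groups of the summands. -/
def dualProj : (N.addNegRankOne K hK).dual →ₗ[ℤ] N.Disc × ZMod K :=
  LinearMap.prod
    ((Submodule.mkQ _).comp ((LinearMap.fst ℤ V ℚ).restrict
      fun x hx => ((N.mem_dual_addNegRankOne K hK).mp hx).1))
    -- On the dual lattice K t is an integer, so `num` recovers it and is additive there.
    (AddMonoidHom.toIntLinearMap (AddMonoidHom.mk'
      (fun x : (N.addNegRankOne K hK).dual => (((K : ℚ) * (x : V × ℚ).2).num : ZMod K))
      (fun x y => by
        obtain ⟨n, hn⟩ := ((N.mem_dual_addNegRankOne K hK).mp x.2).2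
        obtain ⟨m, hm⟩ := ((N.mem_dual_addNegRankOne K hK).mp y.2).2
        have : (K : ℚ) * ((x + y : (N.addNegRankOne K hK).dual) : V × ℚ).2 = (n + m : ℤ) := by
          push_cast
          rw [Prod.snd_add, mul_add, hn, hm]
        rw [this, hn, hm, Rat.num_intCast, Rat.num_intCast, Rat.num_intCast]
        push_cast; rfl)))

theorem dualProj_apply {x : V} {n : ℤ} (hx : x ∈ N.dual)
    (h : (x, (n / K : ℚ)) ∈ (N.addNegRankOne K hK).dual) :
    N.dualProj K hK ⟨(x, (n / K : ℚ)), h⟩ = (Submodule.Quotient.mk ⟨x, hx⟩, (n : ZMod K)) := by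
  refine Prod.ext rfl ?_
  change ((((K : ℚ) * (n / K : ℚ)).num : ℤ) : ZMod K) = n
  have hK0 : (K : ℚ) ≠ 0 := by exact_mod_cast NeZero.ne K
  rw [mul_div_cancel₀ _ hK0, Rat.num_intCast]

theorem mk_mem_dual_addNegRankOne {x : V} (hx : x ∈ N.dual) (n : ℤ) :
    (x, (n / K : ℚ)) ∈ (N.addNegRankOne K hK).dual := by
  have hK0 : (K : ℚ) ≠ 0 := by exact_mod_cast NeZero.ne K
  exact (N.mem_dual_addNegRankOne K hK).mpr ⟨hx, n, mul_div_cancel₀ _ hK0⟩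

theorem exists_eq_of_dual_addNegRankOne (x : (N.addNegRankOne K hK).dual) :
    ∃ (y : N.dual) (n : ℤ), x = ⟨(y, (n / K : ℚ)), N.mk_mem_dual_addNegRankOne K hK y.2 n⟩ := by
  obtain ⟨⟨y, t⟩, hx⟩ := x
  obtain ⟨hy, n, hn⟩ := (N.mem_dual_addNegRankOne K hK).mp hx
  have hK0 : (K : ℚ) ≠ 0 := by exact_mod_cast NeZero.ne K
  refine ⟨⟨y, hy⟩, n, ?_⟩
  rw [Subtype.mk.injEq, Prod.mk.injEq]
  exact ⟨rfl, by rw [← hn, mul_div_cancel_left₀ _ hK0]⟩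

theorem ker_dualProj :
    (N.addNegRankOne K hK).carrier.submoduleOf (N.addNegRankOne K hK).dual =
      LinearMap.ker (N.dualProj K hK) := by
  have hK0 : (K : ℚ) ≠ 0 := by exact_mod_cast NeZero.ne K
  ext x
  obtain ⟨y, n, rfl⟩ := N.exists_eq_of_dual_addNegRankOne K hK x
  rw [LinearMap.mem_ker, dualProj_apply _ _ _ y.2, Prod.mk_eq_zero,
    Submodule.Quotient.mk_eq_zero, ZMod.intCast_zmod_eq_zero_iff_dvd]
  change ((y : V), (n / K : ℚ)) ∈ (N.addNegRankOne K hK).carrier ↔ _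
  rw [mem_carrier_addNegRankOne]
  refine and_congr Iff.rfl ⟨?_, ?_⟩
  · rintro ⟨m, hm⟩
    refine ⟨m, ?_⟩
    have : (n : ℚ) = K * m := by rw [← hm]; field_simp
    exact_mod_cast this
  · rintro ⟨m, rfl⟩
    exact ⟨m, by push_cast; field_simp⟩

theorem dualProj_surjective : Function.Surjective (N.dualProj K hK) := by
  rintro ⟨ν, r⟩
  obtain ⟨y, rfl⟩ := Submodule.Quotient.mk_surjective _ ν
  obtain ⟨n, rfl⟩ := ZMod.intCast_surjective r
  exact ⟨_, N.dualProj_apply K hK y.2 (N.mk_mem_dual_addNegRankOne K hK y.2 n)⟩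

/-- The discriminant group of the orthogonal sum. -/
def discEquiv : (N.addNegRankOne K hK).Disc ≃ₗ[ℤ] N.Disc × ZMod K :=
  (Submodule.quotEquivOfEq _ _ (N.ker_dualProj K hK)).trans
    ((N.dualProj K hK).quotKerEquivOfSurjective (N.dualProj_surjective K hK))

theorem discEquiv_mk (y : N.dual) (n : ℤ) :
    N.discEquiv K hK (Submodule.Quotient.mk
      ⟨(y, (n / K : ℚ)), N.mk_mem_dual_addNegRankOne K hK y.2 n⟩) =
        (Submodule.Quotient.mk y, (n : ZMod K)) :=
  N.dualProj_apply K hK y.2 _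

theorem exists_eq_mk_addNegRankOne (l : (N.addNegRankOne K hK).Disc) :
    ∃ (y : N.dual) (n : ℤ), l = Submodule.Quotient.mk
      ⟨(y, (n / K : ℚ)), N.mk_mem_dual_addNegRankOne K hK y.2 n⟩ := by
  obtain ⟨x, rfl⟩ := Submodule.Quotient.mk_surjective _ l
  obtain ⟨y, n, rfl⟩ := N.exists_eq_of_dual_addNegRankOne K hK x
  exact ⟨y, n, rfl⟩

theorem eNorm_mk (L : EvenLattice V) (x : L.dual) :
    L.eNorm (Submodule.Quotient.mk x) = ee ((L.form x x : ℚ) / 2) := rfl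

theorem ePair_mk (L : EvenLattice V) (x y : L.dual) :
    L.ePair (Submodule.Quotient.mk x) (Submodule.Quotient.mk y) = ee (-(L.form x y : ℚ)) := rfl

/-- The dual of the second summand is (1/K)ℤ and its form is negative, so its factor is e(+nn'/K).
-/
theorem ePair_addNegRankOne (l l' : (N.addNegRankOne K hK).Disc) :
    (N.addNegRankOne K hK).ePair l l' =
      N.ePair (N.discEquiv K hK l).1 (N.discEquiv K hK l').1 *
        ZMod.stdAddChar ((N.discEquiv K hK l').2 * (N.discEquiv K hK l).2) := by
  have hK0 : (K : ℂ) ≠ 0 := by exact_mod_cast NeZero.ne K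
  obtain ⟨y, n, rfl⟩ := N.exists_eq_mk_addNegRankOne K hK l
  obtain ⟨y', n', rfl⟩ := N.exists_eq_mk_addNegRankOne K hK l'
  rw [discEquiv_mk, discEquiv_mk, ePair_mk, ePair_mk, ← Int.cast_mul, stdAddChar_eq_ee, ← ee_add,
    form_addNegRankOne]
  congr 1
  push_cast
  field_simp
  ring

theorem eNorm_addNegRankOne (y : N.dual) (n : ℤ) :
    (N.addNegRankOne K hK).eNorm (Submodule.Quotient.mk
      ⟨(y, (n / K : ℚ)), N.mk_mem_dual_addNegRankOne K hK y.2 n⟩) =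
      N.eNorm (Submodule.Quotient.mk y) * ee (-((n : ℂ) ^ 2 / (2 * K))) := by
  have hK0 : (K : ℂ) ≠ 0 := by exact_mod_cast NeZero.ne K
  rw [eNorm_mk, eNorm_mk, ← ee_add, form_addNegRankOne]
  congr 1
  push_cast
  field_simp
  ring

theorem card_disc_addNegRankOne :
    Nat.card (N.addNegRankOne K hK).Disc = Nat.card N.Disc * K := by
  rw [Nat.card_congr (N.discEquiv K hK).toEquiv, Nat.card_prod, Nat.card_zmod]

end EvenLattice

namespace EvenLattice

variable {V : Type u} [AddCommGroup V] [Module ℚ V]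

/-! ### Vector valued forms and their Fourier expansions -/

/-- The transformation law is multiplicative in the pair (γ, R), so the two generators suffice. -/
theorem transforms_iff (L : EvenLattice V) {κ : ℤ} {f : ℍ → L.Disc → ℂ} :
    L.Transforms κ f ↔
      (∀ τ : ℍ, f (ModularGroup.S • τ) = ((τ : ℂ) ^ (1 / 2 : ℂ)) ^ κ • L.weilS (f τ)) ∧
        ∀ τ : ℍ, f (ModularGroup.T • τ) = L.weilT (f τ) := by
  constructor
  · intro h
    refine ⟨fun τ => h Mp2Z.S L.weilS (Submonoid.subset_closure (by simp)) τ, fun τ => ?_⟩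
    have := h Mp2Z.T L.weilT (Submonoid.subset_closure (by simp)) τ
    simpa [Mp2Z.T] using this
  · rintro ⟨hS, hT⟩ γ R hγ
    have key : ∀ p ∈ L.weilGraph, ∀ τ : ℍ, f (p.1.mat • τ) = p.1.root τ ^ κ • p.2 (f τ) := by
      intro p hp
      induction hp using Submonoid.closure_induction with
      | mem p hp =>
        rcases hp with rfl | rfl
        · exact hS
        · intro τ
          have := hT τ
          simpa [Mp2Z.T] using this
      | one => intro τ; simp
      | mul p q _ _ hp hq =>
        intro τ
        have h1 : f ((p * q).1.mat • τ) = p.1.root (q.1.mat • τ) ^ κ • p.2 (f (q.1.mat • τ)) := by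
          rw [← hp, ← mul_smul]; rfl
        have h2 : ∀ (x : ℂ) (v : L.Disc → ℂ), p.2 (x • v) = x • p.2 v := fun x v =>
          LinearMap.map_smul p.2 x v
        rw [h1, hq, h2, smul_smul, ← mul_zpow]
        rfl
    exact key (γ, R) hγ

theorem weilS_apply (L : EvenLattice V) (v : L.Disc → ℂ) (μ : L.Disc) :
    L.weilS v μ = (Complex.I ^ ((L.signature.2 : ℂ) / 2 - (L.signature.1 : ℂ) / 2) *
      ((Real.sqrt (Nat.card L.Disc))⁻¹ : ℝ)) * ∑ ν, L.ePair μ ν * v ν := by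
  simp [weilS, Matrix.mulVec, dotProduct]

/-- Invariance under T and uniqueness of coefficients confine the exponents to (y,y)/2 + ℤ; the
lower bound at the cusp then provides `B`. -/
theorem hasQExp_of_isWeaklyHolomorphic (L : EvenLattice V) {κ : ℤ} {f : ℍ → L.Disc → ℂ}
    (hf : L.IsWeaklyHolomorphic κ f) (hrat : L.HasRationalCoeffs f) (y : L.dual) :
    ∃ B : ℕ, HasQExp (L.form y y / 2 - B) fun τ => f τ (Submodule.Quotient.mk y) := by
  obtain ⟨c, hc, hcr⟩ := hrat
  set ν : L.Disc := Submodule.Quotient.mk y with hν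
  set q : ℚ := L.form y y / 2 with hq
  have hT := (L.transforms_iff.mp hf.transforms).2
  have hsupp : ∀ n : ℚ, c ν n ≠ 0 → ∃ k : ℤ, n = q + k := by
    intro n hn
    have key := eq_zero_of_hasSum_ee_upperHalfPlane
      (a := fun n : ℚ => c ν n * (ee n - ee q)) fun τ => by
        have h1 := hc.hasSum ν (ModularGroup.T • τ)
        have h2 := (hc.hasSum ν τ).mul_left (ee q)
        have h3 : f (ModularGroup.T • τ) ν = ee q * f τ ν := by
          rw [hT]
          change L.eNorm ν * f τ ν = _
          rw [hν, eNorm_mk, hq]; push_cast; rfl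
        rw [h3] at h1
        have h4 := h1.sub h2
        rw [sub_self] at h4
        refine h4.congr_fun fun n => ?_
        rw [UpperHalfPlane.modular_T_smul, UpperHalfPlane.coe_vadd, Complex.ofReal_one, mul_add,
          mul_one, ee_add]
        ring
    have := sub_eq_zero.mp ((mul_eq_zero.mp (congrFun key n)).resolve_left hn)
    obtain ⟨k, hk⟩ := ee_eq_iff.mp this
    exact ⟨k, by exact_mod_cast hk⟩
  obtain ⟨n₀, hn₀⟩ := hc.bounded_below
  obtain ⟨B, hB⟩ := exists_nat_ge (q - n₀)
  choose r hr using hcr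
  refine ⟨B, HasQExp.of_hasSum (ι := {n // c ν n ≠ 0}) (x := fun n => n.1) (w := fun n => r ν n.1)
    (fun n => ?_) (fun k => ?_) fun τ => ?_⟩
  · obtain ⟨k, hk⟩ := hsupp n.1 n.2
    have h1 : n₀ ≤ n.1 := by
      by_contra h
      exact n.2 (hn₀ ν _ (not_le.mp h))
    have h2 : (0 : ℚ) ≤ (k + B : ℤ) := by push_cast; linarith
    obtain ⟨m, hm⟩ := Int.eq_ofNat_of_zero_le (show 0 ≤ k + B by exact_mod_cast h2)
    refine ⟨m, ?_⟩
    have hm' : (k : ℚ) + B = m := by exact_mod_cast hm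
    rw [hk]; linarith
  · exact Set.Subsingleton.finite fun a ha b hb => Subtype.ext ((show a.1 = _ from ha).trans
      (show b.1 = _ from hb).symm)
  · have h := hc.hasSum ν τ
    simp only [← hr]
    refine (hasSum_subtype_iff_of_support_subset (s := {n | c ν n ≠ 0}) fun n hn => ?_).mpr h
    exact left_ne_zero_of_mul hn

/-- The discriminant group is finite, so the starting exponents have a common lower bound. The
constant term vanishes because the component at 0 starts at a positive exponent. -/
theorem exists_isFourierExpansion (L : EvenLattice V) {h : ℍ → L.Disc → ℂ}
    (hq : ∀ l, ∃ α, HasQExp α fun τ => h τ l) {α₀ : ℚ} (hα₀ : 0 < α₀)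
    (hq0 : HasQExp α₀ fun τ => h τ 0) :
    ∃ c, L.IsFourierExpansion h c ∧ (∀ ν n, ∃ r : ℚ, c ν n = r) ∧ c 0 0 = 0 := by
  have hq' : ∀ l, ∃ α, HasQExp α (fun τ => h τ l) ∧ (l = 0 → 0 < α) := fun l => by
    rcases eq_or_ne l 0 with rfl | hl
    · exact ⟨α₀, hq0, fun _ => hα₀⟩
    · obtain ⟨α, hα⟩ := hq l
      exact ⟨α, hα, fun h => absurd h hl⟩
  choose α hα hα0 using hq'
  choose c hc using hα
  have hinj : ∀ l, Function.Injective fun k : ℕ => α l + (k : ℚ) := fun l a b hab => by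
    simpa using hab
  have hle : ∀ l (n : ℚ), n < α l → n ∉ Set.range fun k : ℕ => α l + (k : ℚ) := by
    rintro l n hn ⟨k, rfl⟩
    have : (0 : ℚ) ≤ k := by positivity
    dsimp only at hn
    linarith
  refine ⟨fun l n => ((Function.extend (fun k : ℕ => α l + (k : ℚ)) (c l) 0 n : ℚ) : ℂ),
    ⟨?_, fun l τ => ?_⟩, fun l n => ⟨_, rfl⟩, ?_⟩
  · obtain ⟨n₀, hn₀⟩ := (Set.finite_range α).bddBelow
    refine ⟨n₀, fun l n hn => ?_⟩
    rw [Function.extend_apply' _ _ _ (hle l n (hn.trans_le (hn₀ ⟨l, rfl⟩)))]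
    simp
  · refine ((hinj l).hasSum_iff fun n hn => ?_).mp ((hc l τ).congr_fun fun k => ?_)
    · rw [Function.extend_apply' _ _ _ hn]; simp
    · rw [Function.comp_apply, (hinj l).extend_apply]
  · dsimp only
    rw [Function.extend_apply' _ _ _ (hle 0 0 (hα0 0 rfl))]
    simp

/-! ### The see-saw with the rank one lattice -/

variable (N : EvenLattice V) (K : ℕ) [NeZero K] (hK : Even K)

/-- The inclusion of `N` as the first summand. -/
def inclusionAddNegRankOne : Inclusion N (N.addNegRankOne K hK) where
  toLin := LinearMap.inl ℚ V ℚ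
  isometry x y := by simp [form_addNegRankOne]
  mem_iff x := by
    rw [mem_carrier_addNegRankOne]
    exact ⟨fun h => h.1, fun h => ⟨h, 0, by simp⟩⟩

theorem mem_perpDual_iff {m : V × ℚ} :
    m ∈ (N.inclusionAddNegRankOne K hK).perpDual ↔ m.1 = 0 ∧ ∃ n : ℤ, K * m.2 = n := by
  have horth : ∀ m : V × ℚ, (∀ x, (N.addNegRankOne K hK).form
      ((N.inclusionAddNegRankOne K hK).toLin x) m = 0) ↔ m.1 = 0 := fun m => by
    simp only [form_addNegRankOne, inclusionAddNegRankOne, LinearMap.inl_apply, zero_mul, mul_zero,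
      sub_zero]
    exact ⟨N.eq_zero_of_form_eq_zero, fun h x => by rw [h, map_zero]⟩
  simp only [Inclusion.perpDual, Inclusion.perp, Set.mem_ofPred_eq, horth]
  simp only [mem_carrier_addNegRankOne, form_addNegRankOne]
  refine and_congr Iff.rfl ⟨fun h => ?_, ?_⟩
  · obtain ⟨n, hn⟩ := h (0, 1) ⟨⟨N.carrier.zero_mem, 1, by simp⟩, rfl⟩
    refine ⟨-n, ?_⟩
    simp only [map_zero] at hn
    push_cast
    linarith
  · rintro ⟨n, hn⟩ y ⟨⟨_, k, hk⟩, hy⟩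
    refine ⟨-(n * k), ?_⟩
    rw [hy, hk, ← mul_assoc, hn, map_zero]
    push_cast; ring

/-- Here M = ℤ and M' = (1/K)ℤ, so the theta functions are unary theta series, nonzero only when the
`N`-components match. -/
theorem mem_thetaSet_iff (l : (N.addNegRankOne K hK).Disc) (ν : N.Disc) (m : V × ℚ) :
    m ∈ (N.inclusionAddNegRankOne K hK).thetaSet l ν ↔ (N.discEquiv K hK l).1 = ν ∧
      ∃ n : ℤ, (n : ZMod K) = (N.discEquiv K hK l).2 ∧ m = (0, (n / K : ℚ)) := by
  have hK0 : (K : ℚ) ≠ 0 := by exact_mod_cast NeZero.ne K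
  rw [Inclusion.thetaSet, Set.mem_ofPred_eq, mem_perpDual_iff]
  constructor
  · rintro ⟨⟨hm, n, hn⟩, x, y, rfl, rfl, h⟩
    obtain ⟨x, k, rfl⟩ := N.exists_eq_of_dual_addNegRankOne K hK x
    rw [discEquiv_mk]
    rw [mem_carrier_addNegRankOne] at h
    obtain ⟨h1, j, hj⟩ := h
    simp only [inclusionAddNegRankOne, LinearMap.inl_apply, Prod.fst_sub, Prod.fst_add,
      Prod.snd_sub, Prod.snd_add, hm, zero_add, add_zero] at h1 hj
    refine ⟨((Submodule.Quotient.eq _).mpr ?_).symm, n, ?_, ?_⟩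
    · exact h1
    · dsimp only
      rw [← sub_eq_zero, ← Int.cast_sub, ZMod.intCast_zmod_eq_zero_iff_dvd]
      refine ⟨j, ?_⟩
      have : (n : ℚ) - k = K * j := by rw [← hj, ← hn]; field_simp
      exact_mod_cast this
    · exact Prod.ext hm (by rw [← hn]; field_simp)
  · rintro ⟨rfl, n, hn, rfl⟩
    refine ⟨⟨rfl, n, by dsimp only; field_simp⟩, ?_⟩
    obtain ⟨y, k, rfl⟩ := N.exists_eq_mk_addNegRankOne K hK l
    rw [discEquiv_mk] at hn ⊢
    refine ⟨_, y, rfl, rfl, ?_⟩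
    rw [mem_carrier_addNegRankOne]
    simp only [inclusionAddNegRankOne, LinearMap.inl_apply, Prod.fst_sub, Prod.fst_add,
      Prod.snd_sub, Prod.snd_add, zero_add, add_zero, sub_self]
    refine ⟨N.carrier.zero_mem, ?_⟩
    dsimp only at hn
    rw [← sub_eq_zero, ← Int.cast_sub, ZMod.intCast_zmod_eq_zero_iff_dvd] at hn
    obtain ⟨j, hj⟩ := hn
    refine ⟨j, ?_⟩
    have : (n : ℚ) - k = K * j := by exact_mod_cast hj
    rw [← sub_div, this]; field_simp

theorem theta_inclusionAddNegRankOne [DecidableEq N.Disc] (l : (N.addNegRankOne K hK).Disc)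
    (ν : N.Disc) (τ : ℍ) :
    (N.inclusionAddNegRankOne K hK).theta l ν τ = if (N.discEquiv K hK l).1 = ν then
      thetaSeries K (Pi.single (N.discEquiv K hK l).2 1) τ 0 else 0 := by
  have hK0 : (K : ℚ) ≠ 0 := by exact_mod_cast NeZero.ne K
  have hKC : (K : ℂ) ≠ 0 := by exact_mod_cast NeZero.ne K
  rw [Inclusion.theta]
  split_ifs with hl
  · let s : Set ℤ := {n | (n : ZMod K) = (N.discEquiv K hK l).2}
    let e : s ≃ (N.inclusionAddNegRankOne K hK).thetaSet l ν :=
      Equiv.ofBijective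
        (fun n => ⟨(0, (n.1 / K : ℚ)), (N.mem_thetaSet_iff K hK l ν _).mpr ⟨hl, n, n.2, rfl⟩⟩) (by
          refine ⟨fun a b hab => ?_, ?_⟩
          · have h := congrArg (fun m => (m.1 : V × ℚ).2) hab
            dsimp only at h
            rw [div_left_inj' hK0] at h
            exact Subtype.ext (by exact_mod_cast h)
          · rintro ⟨m, hm⟩
            obtain ⟨-, n, hn, rfl⟩ := (N.mem_thetaSet_iff K hK l ν m).mp hm
            exact ⟨⟨n, hn⟩, rfl⟩)
    rw [← e.tsum_eq, thetaSeries]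
    have : ∀ n : s, ee (-τ * (((N.addNegRankOne K hK).form (e n : V × ℚ) (e n : V × ℚ) : ℚ) : ℂ)
        / 2) = ee ((n.1 : ℂ) ^ 2 / (2 * K) * τ + n.1 * 0) := fun n => by
      rw [form_addNegRankOne]
      change ee (-τ * ((N.form 0 0 - K * (n.1 / K * (n.1 / K)) : ℚ) : ℂ) / 2) = _
      rw [map_zero]
      congr 1
      push_cast
      field_simp
      ring
    rw [tsum_congr this, tsum_subtype s fun n : ℤ => ee ((n : ℂ) ^ 2 / (2 * K) * τ + n * 0)]
    refine tsum_congr fun n => ?_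
    by_cases hn : (n : ZMod K) = (N.discEquiv K hK l).2
    · rw [Set.indicator_of_mem (show n ∈ s from hn), hn, Pi.single_eq_same, one_mul]
    · rw [Set.indicator_of_notMem (show n ∉ s from hn), Pi.single_eq_of_ne hn, zero_mul]
  · have : IsEmpty ((N.inclusionAddNegRankOne K hK).thetaSet l ν) :=
      ⟨fun m => hl ((N.mem_thetaSet_iff K hK l ν m.1).mp m.2).1⟩
    exact tsum_empty

theorem sum_discEquiv (g : N.Disc × ZMod K → ℂ) :
    ∑ l, g (N.discEquiv K hK l) = ∑ ν, ∑ r, g (ν, r) := by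
  rw [← Fintype.sum_prod_type]
  exact (N.discEquiv K hK).toEquiv.sum_comp g

/-- The tensor product of a form for `N` and a form for the rank one lattice. -/
def tensorForm (f : ℍ → N.Disc → ℂ) (ψ : ZMod K → ℍ → ℂ) :
    ℍ → (N.addNegRankOne K hK).Disc → ℂ :=
  fun τ l => f τ (N.discEquiv K hK l).1 * ψ (N.discEquiv K hK l).2 τ

/-- Only the classes with `N`-component ν contribute, and their sum factors as f_ν times the theta
contraction of ψ. -/
theorem seeSaw_tensorForm (f : ℍ → N.Disc → ℂ) {ψ : ZMod K → ℍ → ℂ}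
    (hψ : ∀ τ, thetaSeries K (fun r => ψ r τ) τ 0 = 1) :
    (N.inclusionAddNegRankOne K hK).seeSaw (N.tensorForm K hK f ψ) = f := by
  classical
  funext τ ν
  rw [Inclusion.seeSaw]
  simp only [theta_inclusionAddNegRankOne, tensorForm]
  rw [N.sum_discEquiv K hK fun p =>
    (if p.1 = ν then thetaSeries K (Pi.single p.2 1) τ 0 else 0) * (f τ p.1 * ψ p.2 τ),
    Finset.sum_eq_single ν (fun μ _ hμ => by simp [hμ]) (by simp)]
  simp only [if_true]
  have h := hψ τ
  rw [thetaSeries_eq_sum] at h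
  calc ∑ r, thetaSeries K (Pi.single r 1) τ 0 * (f τ ν * ψ r τ)
      = f τ ν * ∑ r, ψ r τ * thetaSeries K (Pi.single r 1) τ 0 := by
        rw [Finset.mul_sum]; exact Finset.sum_congr rfl fun r _ => by ring
    _ = f τ ν := by rw [h, mul_one]

/-- The Weil representation of an orthogonal sum is the tensor product of those of the summands. -/
theorem transforms_tensorForm {b : ℕ} (hN : N.signature = (b, 0)) {κ : ℤ}
    {f : ℍ → N.Disc → ℂ} (hf : N.Transforms κ f) {ψ : ZMod K → ℍ → ℂ}
    (hS : ∀ τ r, ψ r (ModularGroup.S • τ) = ((τ : ℂ) ^ (1 / 2 : ℂ))⁻¹ *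
      (Complex.I ^ (1 / 2 : ℂ) * ((Real.sqrt K)⁻¹ : ℝ)) *
        ∑ s : ZMod K, ZMod.stdAddChar (s * r) * ψ s τ)
    (hT : ∀ τ (r : ℤ), ψ r (ModularGroup.T • τ) = ee (-((r : ℂ) ^ 2 / (2 * K))) * ψ r τ) :
    (N.addNegRankOne K hK).Transforms (κ - 1) (N.tensorForm K hK f ψ) := by
  rw [transforms_iff] at hf ⊢
  refine ⟨fun τ => ?_, fun τ => ?_⟩
  · have hroot : (τ : ℂ) ^ (1 / 2 : ℂ) ≠ 0 := by
      rw [Ne, Complex.cpow_eq_zero_iff]; exact fun h => τ.ne_zero h.1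
    funext l
    rw [Pi.smul_apply, weilS_apply, card_disc_addNegRankOne, N.signature_addNegRankOne K hK hN]
    simp only [tensorForm, hf.1, hS, ePair_addNegRankOne, Pi.smul_apply, weilS_apply, hN]
    rw [N.sum_discEquiv K hK fun p =>
      N.ePair (N.discEquiv K hK l).1 p.1 * ZMod.stdAddChar (p.2 * (N.discEquiv K hK l).2) *
        (f τ p.1 * ψ p.2 τ)]
    have hsum : ∑ μ : N.Disc, ∑ s : ZMod K, N.ePair (N.discEquiv K hK l).1 μ *
        ZMod.stdAddChar (s * (N.discEquiv K hK l).2) * (f τ μ * ψ s τ) =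
        (∑ μ, N.ePair (N.discEquiv K hK l).1 μ * f τ μ) *
          ∑ s, ZMod.stdAddChar (s * (N.discEquiv K hK l).2) * ψ s τ := by
      rw [Finset.sum_mul_sum]
      exact Finset.sum_congr rfl fun _ _ => Finset.sum_congr rfl fun _ _ => by ring
    -- The additional negative direction accounts for the factor i^{1/2} in the law for ψ.
    have hI : Complex.I ^ (((1 : ℕ) : ℂ) / 2 - (b : ℂ) / 2) =
        Complex.I ^ (((0 : ℕ) : ℂ) / 2 - (b : ℂ) / 2) * Complex.I ^ (1 / 2 : ℂ) := by
      rw [← Complex.cpow_add _ _ Complex.I_ne_zero]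
      congr 1; push_cast; ring
    rw [hsum, hI, zpow_sub_one₀ hroot, Nat.cast_mul, Real.sqrt_mul (by positivity), mul_inv]
    simp only [smul_eq_mul]
    push_cast
    ring
  · funext l
    change _ = (N.addNegRankOne K hK).eNorm l * _
    simp only [tensorForm, hf.2]
    change N.eNorm _ * f τ _ * _ = _
    obtain ⟨y, n, rfl⟩ := N.exists_eq_mk_addNegRankOne K hK l
    rw [discEquiv_mk, hT, eNorm_addNegRankOne]
    ring

end EvenLattice

/-! ### Assembly of `P` and `h` -/

theorem mainTheorem5 {V : Type u} [AddCommGroup V] [Module ℚ V]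
    (N : EvenLattice V) (hN : N.signature = (2, 0))
    (f : ℍ → N.Disc → ℂ) (hf : N.IsWeaklyHolomorphic 2 f)
    (hrat : N.HasRationalCoeffs f) (hconst : N.HasZeroConstantTerm f) :
    ∃ (W : Type u) (_ : AddCommGroup W) (_ : Module ℚ W) (P : EvenLattice W)
      (i : EvenLattice.Inclusion N P) (h : ℍ → P.Disc → ℂ),
      P.signature = (2, 1) ∧
      (∃ z : W, P.IsPrimitive z ∧ P.form z z = 0) ∧
      P.IsWeaklyHolomorphic 1 h ∧
      P.HasRationalCoeffs h ∧
      P.HasZeroConstantTerm h ∧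
      i.seeSaw h = f := by
  obtain ⟨x, hx, d, hd, hxd⟩ := N.exists_form_pos (by rw [hN]; norm_num)
  obtain ⟨B, hB⟩ := N.hasQExp_of_isWeaklyHolomorphic hf hrat 0
  -- The factor 6 makes 12Q = 72dl² = 2d(6l)², the norm of 6l x. Since f_0 has a pole of order at
  -- most B, vanishing of ψ_0 to order B + 1 makes the product start at q.
  obtain ⟨l, a, hl, ha, hshort⟩ := exists_sum_five_squares (6 * d) (B + 1) (by omega)
  set Q := 6 * d * l ^ 2 with hQ
  have : NeZero Q := ⟨by positivity⟩
  have hK : Even (12 * Q) := ⟨6 * Q, by ring⟩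
  have htrans : (N.addNegRankOne (12 * Q) hK).Transforms 1
      (N.tensorForm (12 * Q) hK f (weilVector a Q)) :=
    N.transforms_tensorForm (12 * Q) hK hN hf.transforms (weilVector_S_smul ha) fun τ r => by
      rw [weilVector_T_smul ha]
      congr 4
      push_cast; ring
  have hq : ∀ l, ∃ α, HasQExp α fun τ => N.tensorForm (12 * Q) hK f (weilVector a Q) τ l := by
    intro l
    obtain ⟨y, n, rfl⟩ := N.exists_eq_mk_addNegRankOne (12 * Q) hK l
    obtain ⟨C, hC⟩ := N.hasQExp_of_isWeaklyHolomorphic hf hrat y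
    obtain ⟨α, hα⟩ := hasQExp_weilVector ha (n : ZMod (12 * Q))
    refine ⟨_, (hC.mul hα).congr fun τ => ?_⟩
    rw [EvenLattice.tensorForm, EvenLattice.discEquiv_mk]
  have hq0 : HasQExp 1 fun τ => N.tensorForm (12 * Q) hK f (weilVector a Q) τ 0 := by
    have h := hB.mul (hasQExp_weilVector_zero (Q := Q) hshort)
    have e : N.form ((0 : N.dual) : V) ((0 : N.dual) : V) / 2 - B + ((B + 1 : ℕ) : ℚ) = 1 := by
      simp
    rw [e] at h
    refine h.congr fun τ => ?_
    rw [EvenLattice.tensorForm, map_zero]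
    rfl
  obtain ⟨c, hc, hcr, hc0⟩ := EvenLattice.exists_isFourierExpansion _ hq one_pos hq0
  refine ⟨V × ℚ, inferInstance, inferInstance, N.addNegRankOne (12 * Q) hK,
    N.inclusionAddNegRankOne (12 * Q) hK, N.tensorForm (12 * Q) hK f (weilVector a Q),
    N.signature_addNegRankOne _ hK hN, ⟨((6 * l) • x, 1), ⟨?_, ?_, ?_⟩, ?_⟩,
    ⟨fun l => ?_, htrans, c, hc⟩, ⟨c, hc, hcr⟩, ⟨c, hc, hc0⟩,
    N.seeSaw_tensorForm _ hK f (thetaSeries_weilVector ha)⟩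
  · exact (N.mem_carrier_addNegRankOne _ hK).mpr ⟨nsmul_mem hx _, 1, by simp⟩
  · intro h
    simpa using congrArg Prod.snd h
  -- The last coordinate of the vector is 1, so any integer dividing it is a unit.
  · intro k y hy hk
    obtain ⟨-, n, hn⟩ := (N.mem_carrier_addNegRankOne _ hK).mp hy
    have h := congrArg Prod.snd hk
    rw [Prod.smul_snd, hn, zsmul_eq_mul] at h
    exact IsUnit.of_mul_eq_one n (by exact_mod_cast (show ((1 : ℚ)) = k * n from h).symm)
  · rw [EvenLattice.form_addNegRankOne]
    simp only [map_nsmul, LinearMap.smul_apply, nsmul_eq_mul, hxd, hQ]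
    push_cast; ring
  · obtain ⟨α, hα⟩ := hq l
    exact hα.mdifferentiable

end
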